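/- Let $n,m$ be natural numbers, $\Omega\subset\mathbb{R}^n$ a domain (a non-empty connected open set) and $F:\Omega\to\mathbb{R}^m$ a smooth map with graph $\Sigma=\{(x,F(x)):x\in\Omega\}\subset\mathbb{R}^n\times\mathbb{R}^m$. The map $F$ is called \emph{minimal} if the mean curvature vector of $\Sigma$ vanishes identically. \textbf{The form $\Theta(F)$.} At $p=(x,F(x))\in\Sigma$ let $S=\mathrm{d}F|_x$, $G=I_n+S^*S$, $H=I_m+SS^*$, and let $L:\mathbb{R}^n\to T_p\Sigma$ and $L^\perp:\mathbb{R}^m\to N_p\Sigma$ be the isometries $L(v)=(G^{-1/2}v,\,SG^{-1/2}v)$ and $L^\perp(w)=(-S^*H^{-1/2}w,\,H^{-1/2}w)$. Put $J=L^\perp\circ S\circ L^{-1}:T_p\Sigma\to N_p\Sigma$ and, for a covector $\xi$ of any degree on $\mathbb{R}^n\times\mathbb{R}^m$, \[\Psi(\xi)=\sum_{i=1}^n (J(e_i))^\flat\wedge\iota_{e_i}\xi,\] where $e_1,\dots,e_n$ is an orthonormal basis of $T_p\Sigma$. Let $\Psi^\ell(F)=\Psi^\ell(\mathrm{vol}_\Sigma)$,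 where $\mathrm{vol}_\Sigma$ is the volume form of $\Sigma$ (oriented by its projection to $\mathbb{R}^n$ and extended by zero on normal vectors). Define \[\Theta(F)=\Psi^0(F)-\sum_{\ell\ge1}(-1)^\ell\,\frac{\ell-1}{\ell!}\,\Psi^\ell(F),\] and extend it to an $n$-form on $\Omega\times\mathbb{R}^m$ by parallel transport along the $\mathbb{R}^m$-factor. A smooth $n$-form on $\Omega\times\mathbb{R}^m$ is a \emph{calibration} if it is closed and its comass (the supremum of its values on all oriented unit $n$-planes at all points) is at most one. \textbf{Theorem.} There is an absolute constant $\varepsilon>0$ with the following property. Let $n,m$ be arbitrary, let $\Omega\subset\mathbb{R}^n$ be a domain and $F:\Omega\to\mathbb{R}^m$ a minimal map with $r=\sup_{x\in\Omega}\operatorname{rank}(\mathrm{d}F|_x)\ge2$. If at every point of $\Omega$ the singular values $\lambda_1\ge\lambda_2\ge\cdots$ of $\mathrm{d}F$ satisfy \[\lambda_j\lambda_k\le\frac{\varepsilon}{r-1}\qquad\text{for all }1\le j<k\le r,\] then $\Theta(F)$ is a calibration. -/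

import Mathlib

open scoped ContDiff

noncomputable section

namespace MinimalGraph

/-- Euclidean space `ℝⁿ`. -/
abbrev E (n : ℕ) : Type := EuclideanSpace ℝ (Fin n)

/-- The ambient Euclidean space `ℝⁿ × ℝᵐ = ℝⁿ⁺ᵐ`, with the product inner product. -/
abbrev Amb (n m : ℕ) : Type := WithLp 2 (E n × E m)

variable {n m : ℕ}

/-! ### Differential forms: calibrations -/

section Calibration

variable {V : Type*} [NormedAddCommGroup V] [InnerProductSpace ℝ V] {k : ℕ}

/-- The comass on `U` of a `k`-form: the supremum of its values over all oriented unit `k`-planes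
(represented by orthonormal `k`-frames) at points of `U`, taken in the extended reals. -/
def comass (Θ : V → V [⋀^Fin k]→L[ℝ] ℝ) (U : Set V) : EReal :=
  ⨆ p ∈ U, ⨆ v : {v : Fin k → V // Orthonormal ℝ v}, ((Θ p v.1 : ℝ) : EReal)

/-- A calibration on the open set `U`: a smooth closed form with comass at most one. -/
structure IsCalibration (Θ : V → V [⋀^Fin k]→L[ℝ] ℝ) (U : Set V) : Prop where
  smooth : ContDiffOn ℝ ∞ Θ U
  closed : ∀ p ∈ U, extDeriv Θ p = 0
  comass_le_one : comass Θ U ≤ 1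

/-- The wedge product `α ∧ η` of a covector with a `k`-covector:
`(α ∧ η)(v₀, …, vₖ) = ∑ⱼ (-1)ʲ α(vⱼ) η(v₀, …, v̂ⱼ, …, vₖ)`. -/
def wedgeOne (α : V →L[ℝ] ℝ) (η : V [⋀^Fin k]→L[ℝ] ℝ) : V [⋀^Fin (k + 1)]→L[ℝ] ℝ :=
  ContinuousAlternatingMap.alternatizeUncurryFin (α.smulRight η)

/-- Interior multiplication `ι_e ξ = ξ(e, ·, …, ·)`. -/
def interiorMul (e : V) (ξ : V [⋀^Fin (k + 1)]→L[ℝ] ℝ) : V [⋀^Fin k]→L[ℝ] ℝ :=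
  ξ.curryLeft e

end Calibration

/-! ### The graph of a map and its mean curvature -/

/-- The Jacobian matrix `(∂ⱼ f_α)` of `F` at `x`. -/
def jacobian (F : E n → E m) (x : E n) : Matrix (Fin m) (Fin n) ℝ :=
  Matrix.of fun α j => (fderiv ℝ F x (EuclideanSpace.single j 1)) α

/-- `G = I + S* S`, the matrix of the induced metric of the graph when `S = dF`. -/
def matG (S : Matrix (Fin m) (Fin n) ℝ) : Matrix (Fin n) (Fin n) ℝ := 1 + S.transpose * S

/-- `H = I + S S*`. -/
def matH (S : Matrix (Fin m) (Fin n) ℝ) : Matrix (Fin m) (Fin m) ℝ := 1 + S * S.transpose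

/-- The parametrization `x ↦ (x, F x)` of the graph of `F`. -/
def graphMap (F : E n → E m) (x : E n) : Amb n m := WithLp.toLp 2 (x, F x)

/-- The tangent space of the graph of `F` at `(x, F x)`. -/
def tangentSpace (F : E n → E m) (x : E n) : Submodule ℝ (Amb n m) :=
  LinearMap.range (fderiv ℝ (graphMap F) x : E n →ₗ[ℝ] Amb n m)

/-- The second fundamental form of the graph of `F` at `(x, F x)`, as a function of vectors of the
parameter domain: the orthogonal projection of the second derivative of `x ↦ (x, F x)` onto the
normal space. -/
def secondFundamentalForm (F : E n → E m) (x u v : E n) : Amb n m :=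
  (tangentSpace F x)ᗮ.starProjection (fderiv ℝ (fderiv ℝ (graphMap F)) x u v)

/-- The mean curvature vector of the graph of `F` at `(x, F x)`: the trace of the second
fundamental form with respect to the induced metric. -/
def meanCurvature (F : E n → E m) (x : E n) : Amb n m :=
  ∑ j, ∑ k, (matG (jacobian F x))⁻¹ j k •
    secondFundamentalForm F x (EuclideanSpace.single j 1) (EuclideanSpace.single k 1)

/-- `F` is a minimal map on `Ω`: it is smooth and the mean curvature of its graph vanishes
identically. -/
structure IsMinimalMap (F : E n → E m) (Ω : Set (E n)) : Prop where
  smooth : ContDiffOn ℝ ∞ F Ω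
  meanCurvature_eq_zero : ∀ x ∈ Ω, meanCurvature F x = 0

/-- The supremum over `Ω` of the rank of `dF`. All the ranks are at most `n`. -/
def supRank (F : E n → E m) (Ω : Set (E n)) : ℕ :=
  ⨆ x : Ω, Module.finrank ℝ (LinearMap.range (fderiv ℝ F x : E n →ₗ[ℝ] E m))

/-! ### The form `Θ(F)` -/

/-- `A^{-1/2}` for a symmetric positive definite real matrix `A`. -/
def invSqrt (A : Matrix (Fin n) (Fin n) ℝ) : Matrix (Fin n) (Fin n) ℝ :=
  cfc (fun t : ℝ => (Real.sqrt t)⁻¹) A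

/-- The linear map `v ↦ (A v, B v)` from `ℝᵏ` to `ℝⁿ × ℝᵐ`. -/
def pairMap {k : ℕ} (A : Matrix (Fin n) (Fin k) ℝ) (B : Matrix (Fin m) (Fin k) ℝ) :
    E k →L[ℝ] Amb n m :=
  ((WithLp.prodContinuousLinearEquiv 2 ℝ (E n) (E m)).symm : E n × E m →L[ℝ] Amb n m) ∘L
    ((LinearMap.toContinuousLinearMap (Matrix.toEuclideanLin A)).prod
      (LinearMap.toContinuousLinearMap (Matrix.toEuclideanLin B)))

theorem pairMap_apply {k : ℕ} (A : Matrix (Fin n) (Fin k) ℝ) (B : Matrix (Fin m) (Fin k) ℝ)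
    (v : E k) : pairMap A B v =
      WithLp.toLp 2 (WithLp.toLp 2 (A.mulVec v.ofLp), WithLp.toLp 2 (B.mulVec v.ofLp)) :=
  rfl

/-- The isometry `L(v) = (G^{-1/2} v, S G^{-1/2} v)` of `ℝⁿ` onto the tangent space
`{(u, S u)}` of the graph. -/
def tangentIso (S : Matrix (Fin m) (Fin n) ℝ) : E n →L[ℝ] Amb n m :=
  pairMap (invSqrt (matG S)) (S * invSqrt (matG S))

/-- The isometry `L^⊥(w) = (-S* H^{-1/2} w, H^{-1/2} w)` of `ℝᵐ` onto the normal space of the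
graph. -/
def normalIso (S : Matrix (Fin m) (Fin n) ℝ) : E m →L[ℝ] Amb n m :=
  pairMap (-(S.transpose * invSqrt (matH S))) (invSqrt (matH S))

theorem matG_posDef (S : Matrix (Fin m) (Fin n) ℝ) : (matG S).PosDef :=
  Matrix.PosDef.one.add_posSemidef (by
    simpa using Matrix.posSemidef_conjTranspose_mul_self S)

theorem invSqrt_transpose (A : Matrix (Fin n) (Fin n) ℝ) :
    (invSqrt A).transpose = invSqrt A := by
  have h : IsSelfAdjoint (invSqrt A) := cfc_predicate _ _
  simpa [IsSelfAdjoint, Matrix.star_eq_conjTranspose] using h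

theorem invSqrt_mul {A : Matrix (Fin n) (Fin n) ℝ} (hA : A.PosDef) :
    invSqrt A * A * invSqrt A = 1 := by
  have hs : IsSelfAdjoint A := hA.isHermitian
  have hpos : ∀ t ∈ spectrum ℝ A, 0 < t := by
    intro t ht
    rw [hA.isHermitian.spectrum_real_eq_range_eigenvalues] at ht
    obtain ⟨i, rfl⟩ := ht
    exact hA.eigenvalues_pos i
  have hc : ContinuousOn (fun t : ℝ => (Real.sqrt t)⁻¹) (spectrum ℝ A) :=
    Real.continuous_sqrt.continuousOn.inv₀ fun t ht => (Real.sqrt_pos.2 (hpos t ht)).ne'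
  have hid : ContinuousOn (fun t : ℝ => t) (spectrum ℝ A) := continuousOn_id
  have h1 : invSqrt A * A = cfc (fun t : ℝ => (Real.sqrt t)⁻¹ * t) A := by
    rw [cfc_mul _ _ A hc hid, cfc_id' ℝ A, invSqrt]
  rw [h1, invSqrt, ← cfc_mul (fun t : ℝ => (Real.sqrt t)⁻¹ * t) _ A (hc.mul hid) hc, ← cfc_one ℝ A]
  refine cfc_congr fun t ht => ?_
  have h2 := Real.sqrt_pos.2 (hpos t ht)
  have h3 := Real.mul_self_sqrt (hpos t ht).le
  simp only [Pi.one_apply]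
  field_simp
  nlinarith

theorem tangentIso_inner (S : Matrix (Fin m) (Fin n) ℝ) (u v : E n) :
    inner ℝ (tangentIso S u) (tangentIso S v) = inner ℝ u v := by
  have h := invSqrt_mul (matG_posDef S)
  have key : ∀ (R : Matrix (Fin n) (Fin n) ℝ) (x y : Fin n → ℝ), R.transpose = R →
      R * matG S * R = 1 →
      R.mulVec x ⬝ᵥ R.mulVec y + (S * R).mulVec x ⬝ᵥ (S * R).mulVec y = x ⬝ᵥ y := by
    intro R x y hR hR1
    have e : ∀ {p : ℕ} (M : Matrix (Fin p) (Fin n) ℝ),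
        M.mulVec x ⬝ᵥ M.mulVec y = x ⬝ᵥ (M.transpose * M).mulVec y := by
      intro p M
      rw [← Matrix.mulVec_mulVec, Matrix.dotProduct_mulVec x, Matrix.vecMul_transpose]
    rw [e, e, ← dotProduct_add, ← Matrix.add_mulVec]
    have : R.transpose * R + (S * R).transpose * (S * R) = 1 := by
      rw [← hR1, matG, Matrix.transpose_mul, hR]
      simp only [mul_add, add_mul, mul_one, Matrix.mul_assoc]
    rw [this, Matrix.one_mulVec]
  have k := key _ v.ofLp u.ofLp (invSqrt_transpose _) h
  rw [tangentIso, pairMap_apply, pairMap_apply]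
  simp only [WithLp.prod_inner_apply, EuclideanSpace.inner_eq_star_dotProduct, star_trivial]
  exact k

theorem tangentIso_adjoint_apply (S : Matrix (Fin m) (Fin n) ℝ) (v : E n) :
    ContinuousLinearMap.adjoint (tangentIso S) (tangentIso S v) = v := by
  refine ext_inner_right ℝ fun w => ?_
  rw [ContinuousLinearMap.adjoint_inner_left, tangentIso_inner]

/-- The map `J = L^⊥ ∘ S ∘ L⁻¹` from the tangent space to the normal space. It is extended by zero
to the normal space: the inverse of the isometry `L` on its range is the adjoint of `L`
(see `tangentIso_adjoint_apply`). -/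
def tangentToNormal (S : Matrix (Fin m) (Fin n) ℝ) : Amb n m →L[ℝ] Amb n m :=
  normalIso S ∘L LinearMap.toContinuousLinearMap (Matrix.toEuclideanLin S) ∘L
    ContinuousLinearMap.adjoint (tangentIso S)

/-- The orthonormal basis `e_i = L(∂/∂x_i)` of the tangent space of the graph
(see `tangentFrame_orthonormal`). -/
def tangentFrame (S : Matrix (Fin m) (Fin n) ℝ) (i : Fin n) : Amb n m :=
  tangentIso S (EuclideanSpace.single i 1)

theorem tangentFrame_orthonormal (S : Matrix (Fin m) (Fin n) ℝ) :
    Orthonormal ℝ (tangentFrame S) := by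
  rw [orthonormal_iff_ite]
  intro i j
  rw [tangentFrame, tangentFrame, tangentIso_inner]
  exact orthonormal_iff_ite.1 (EuclideanSpace.orthonormal_single (𝕜 := ℝ) (ι := Fin n)) i j

/-- The volume form of the tangent space of the graph, oriented by its projection to `ℝⁿ`, as an
`n`-covector of the ambient space which vanishes on normal vectors: `e_1^♭ ∧ ⋯ ∧ e_n^♭`, that is,
`(v_1, …, v_n) ↦ det ⟨e_i, v_j⟩`. -/
def volForm (S : Matrix (Fin m) (Fin n) ℝ) : Amb n m [⋀^Fin n]→L[ℝ] ℝ :=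
  { (Matrix.detRowAlternating (R := ℝ) (n := Fin n)).compLinearMap
      (LinearMap.pi fun i => (innerSL ℝ (tangentFrame S i) : Amb n m →ₗ[ℝ] ℝ)) with
    cont := by
      change Continuous fun v : Fin n → Amb n m =>
        Matrix.det (fun j i => inner ℝ (tangentFrame S i) (v j))
      exact Continuous.matrix_det (by fun_prop) }

theorem volForm_apply (S : Matrix (Fin m) (Fin n) ℝ) (v : Fin n → Amb n m) :
    volForm S v = Matrix.det (Matrix.of fun i j => inner ℝ (tangentFrame S i) (v j)) := by
  rw [← Matrix.det_transpose]
  rfl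

/-- The endomorphism `Ψ(ξ) = ∑ᵢ (J eᵢ)^♭ ∧ ι_{eᵢ} ξ` on `k`-covectors. -/
def Psi (S : Matrix (Fin m) (Fin n) ℝ) :
    {k : ℕ} → (Amb n m [⋀^Fin k]→L[ℝ] ℝ) → (Amb n m [⋀^Fin k]→L[ℝ] ℝ)
  | 0, _ => 0
  | _ + 1, ξ => ∑ i : Fin n,
      wedgeOne (innerSL ℝ (tangentToNormal S (tangentFrame S i))) (interiorMul (tangentFrame S i) ξ)

/-- The `n`-covector `Ψ⁰ - ∑_{ℓ ≥ 1} (-1)^ℓ (ℓ - 1)/ℓ! Ψ^ℓ` attached to a linear map `S`, where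
`Ψ^ℓ` is the `ℓ`-th iterate of `Ψ` applied to the volume form; `Ψ^ℓ = 0` for `ℓ > n`, as it lies
in `Λ^ℓ N* ⊗ Λ^{n-ℓ} T*`. -/
def thetaCovector (S : Matrix (Fin m) (Fin n) ℝ) : Amb n m [⋀^Fin n]→L[ℝ] ℝ :=
  volForm S - ∑ l ∈ Finset.Icc 1 n,
    ((-1 : ℝ) ^ l * ((l : ℝ) - 1) / (l.factorial : ℝ)) • (Psi S)^[l] (volForm S)

/-- The `n`-form `Θ(F)` on `Ω × ℝᵐ`. Its value at `(x, y)` is its value at the point `(x, F x)` of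
the graph, transported parallelly along `ℝᵐ`. -/
def Theta (F : E n → E m) (p : Amb n m) : Amb n m [⋀^Fin n]→L[ℝ] ℝ :=
  thetaCovector (jacobian F p.fst)

/-- The cylinder `Ω × ℝᵐ`. -/
def cylinder (m : ℕ) (Ω : Set (E n)) : Set (Amb n m) := {p | p.fst ∈ Ω}

end MinimalGraph

end

/-! Evaluate Θ on a frame v at a point. Let M and Z be the matrices of tangential and normal
coordinates of v relative to the graph, and N = SᵀZ the matrix of ⟨J eᵢ, vⱼ⟩. Since Ψ is the
derivation extending the transpose of J, whose square is zero, ∑ (-t)^ℓ Ψ^ℓ/ℓ! takes on v the value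
f(t) = det(M - tN), and Θ(v) = f(1) - f'(1) (`thetaCovector_eq_thetaDet`). Closedness and the comass
bound both come from this formula.

Closedness. With X, Y the ℝⁿ- and ℝᵐ-coordinates of v, M - tN = G^{1/2}(X - (t-1)B), where B =
G⁻¹Sᵀ(Y - SX). Only the first-order expansion at t = 1 enters Θ, so no term contains two factors dy:
Θ is a multiple of dx plus the terms in which some dxᵢ is replaced by dyₐ, with coefficient the flux
√g g^{ij}∂ⱼfₐ (`thetaCovector_eq_coeff`). Hence dΘ is, up to sign, ∑ₐ (div flux)ₐ dyₐ ∧ dx, and the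
divergences vanish by the minimal surface system g^{ij}∂ᵢ∂ⱼfₐ = 0 (`sum_fluxDeriv_eq_zero`,
`extDeriv_Theta`).

Comass. A singular value decomposition of S turns N into diag(λ)Z' with det(MᵀM + Z'ᵀZ') ≤ 1.
Expanding by rows, Θ(v) is, up to sign, det M + ∑ (-1)^{|I|}(1 - |I|) λ_I m_I, where m_I is the
minor with the rows I taken from Z'. The sets with |I| = 1 drop out, and this is where the
combination f - f' matters. The remaining minors are of second order in the deviation from the
tangent plane: with E = ∑_{|I|≥2} m_I² and d = |det M| one has d² + E ≤ 1 and d²E ≤ (1 - d²)²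
(`sum_sq_minors_le`, `sq_det_mul_sum_sq_minors_le`). The bound on λⱼλₖ makes the total square of the
weights at most 1/16 (`sum_weights_le`), and Cauchy–Schwarz gives |Θ(v)| ≤ 1
(`abs_det_add_sum_minors_le_one`, `thetaCovector_le_one`). -/

noncomputable section

namespace MinimalGraph

/-! ### Determinant inequalities for minors mixing rows of two matrices -/

section Minors

variable {ι : Type*} [Fintype ι] [DecidableEq ι]

/-- The matrix whose rows in `I` are those of `A`, and whose other rows are those of `B`. -/
def mixRows (I : Finset ι) (A B : Matrix ι ι ℝ) : Matrix ι ι ℝ :=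
  Matrix.of fun i j => if i ∈ I then A i j else B i j

theorem mixRows_empty {ι : Type*} [DecidableEq ι] (A B : Matrix ι ι ℝ) : mixRows ∅ A B = B := by
  ext i j
  simp [mixRows]

theorem det_mixRows_one (A : Matrix ι ι ℝ) (I : Finset ι) :
    (mixRows I A 1).det = (A.submatrix (Subtype.val : I → ι) (Subtype.val : I → ι)).det := by
  rw [← Matrix.det_piecewise_one_eq_submatrix_det]
  congr 1
  ext i j
  by_cases hi : i ∈ I <;> simp [mixRows, hi]

theorem det_add_eq_sum_mixRows (A B : Matrix ι ι ℝ) :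
    (A + B).det = ∑ I : Finset ι, (mixRows I A B).det := by
  refine ((Matrix.detRowAlternating (R := ℝ) (n := ι)).map_add_univ A B).trans
    (Finset.sum_congr rfl fun I _ => ?_)
  change Matrix.det _ = _
  congr 1
  ext i j
  by_cases hi : i ∈ I <;> simp [mixRows, hi, Finset.piecewise]

theorem det_one_add_eq_prod {B : Matrix ι ι ℝ} (hB : B.IsHermitian) :
    (1 + B).det = ∏ i, (1 + hB.eigenvalues i) := by
  have h := Matrix.eval_charpoly B (-1)
  rw [hB.charpoly_eq, Polynomial.eval_prod] at h
  have e : (Matrix.scalar ι (-1 : ℝ)) - B = -(1 + B) := by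
    rw [map_neg, map_one]; abel
  rw [e, Matrix.det_neg] at h
  have h2 : ∏ i, Polynomial.eval (-1 : ℝ) (Polynomial.X - Polynomial.C ((hB.eigenvalues i : ℝ)))
      = (-1) ^ Fintype.card ι * ∏ i, (1 + hB.eigenvalues i) := by
    rw [← Finset.card_univ, ← Finset.prod_const, ← Finset.prod_mul_distrib]
    refine Finset.prod_congr rfl fun i _ => ?_
    simp; ring
  have h3 := h2.symm.trans h
  exact (mul_left_cancel₀ (pow_ne_zero _ (by norm_num)) h3).symm

theorem one_le_det_one_add {B : Matrix ι ι ℝ} (hB : B.PosSemidef) : 1 ≤ (1 + B).det := by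
  rw [det_one_add_eq_prod hB.isHermitian]
  have h := Finset.prod_le_prod (s := Finset.univ) (f := fun _ : ι => (1 : ℝ))
    (g := fun i => 1 + hB.isHermitian.eigenvalues i) (fun _ _ => zero_le_one)
    fun i _ => by linarith [hB.eigenvalues_nonneg i]
  simpa using h

/-- If A = C*C is invertible, factoring out C reduces to the case A = 1, where every eigenvalue of
the sum is at least 1. -/
theorem det_le_det_add {A B : Matrix ι ι ℝ} (hA : A.PosSemidef) (hB : B.PosSemidef) :
    A.det ≤ (A + B).det := by
  by_cases h0 : A.det = 0
  · rw [h0]; exact (hA.add hB).det_nonneg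
  obtain ⟨C, rfl⟩ : ∃ C : Matrix ι ι ℝ, A = C.conjTranspose * C := by
    open scoped MatrixOrder in
    exact CStarAlgebra.nonneg_iff_eq_star_mul_self.1 hA.nonneg
  have hC : IsUnit C.det := by
    rw [Matrix.det_mul] at h0
    exact (right_ne_zero_of_mul h0).isUnit
  have hCt : IsUnit C.conjTranspose.det := by simpa using hC
  have e : C.conjTranspose * C + B =
      C.conjTranspose * (1 + (C⁻¹).conjTranspose * B * C⁻¹) * C := by
    rw [Matrix.conjTranspose_nonsing_inv, mul_add, add_mul, mul_one]
    congr 1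
    rw [← Matrix.mul_assoc, ← Matrix.mul_assoc, Matrix.mul_nonsing_inv _ hCt, Matrix.one_mul,
      Matrix.mul_assoc, Matrix.nonsing_inv_mul _ hC, Matrix.mul_one]
  rw [e, Matrix.det_mul, Matrix.det_mul, Matrix.det_mul]
  have h1 := one_le_det_one_add (hB.conjTranspose_mul_mul_same C⁻¹)
  have h2 : 0 ≤ C.conjTranspose.det * C.det := by
    simpa using mul_self_nonneg C.det
  nlinarith

/-- The I-block of AᵀA is CᵀC + DᵀD, with C the I-block of A and D the remaining rows of the same
columns; dropping DᵀD only decreases the determinant. -/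
theorem sq_det_mixRows_le (A : Matrix ι ι ℝ) (I : Finset ι) :
    (mixRows I A 1).det ^ 2 ≤
      (mixRows I (A.transpose * A) 1).det := by
  rw [det_mixRows_one, det_mixRows_one]
  set C := A.submatrix (Subtype.val : I → ι) (Subtype.val : I → ι)
  set D := A.submatrix (Subtype.val : {i // i ∉ I} → ι) (Subtype.val : I → ι)
  have e : (A.transpose * A).submatrix (Subtype.val : I → ι) (Subtype.val : I → ι) =
      C.conjTranspose * C + D.conjTranspose * D := by
    ext i j
    simp only [Matrix.submatrix_apply, Matrix.mul_apply, Matrix.transpose_apply, Matrix.add_apply,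
      Matrix.conjTranspose_apply, star_trivial, C, D]
    rw [← Fintype.sum_subtype_add_sum_subtype (· ∈ I) fun k => A k i * A k j]
    congr!
  rw [e]
  refine le_trans (le_of_eq ?_) (det_le_det_add (Matrix.posSemidef_conjTranspose_mul_self C)
    (Matrix.posSemidef_conjTranspose_mul_self D))
  rw [Matrix.det_mul, Matrix.det_conjTranspose, star_trivial, sq]

theorem sum_det_mixRows_one (B : Matrix ι ι ℝ) :
    ∑ I : Finset ι, (mixRows I B 1).det = (1 + B).det := by
  rw [add_comm, det_add_eq_sum_mixRows]

/-- With P the product and t the sum, induction gives P ≥ 1 + t and P(1 - t) ≤ 1. Hence P - 1 - t ≤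
(P - 1)t ≤ (P - 1)². -/
theorem prod_one_add_sub_le {κ : Type*} (s : Finset κ) (b : κ → ℝ) (hb : ∀ i ∈ s, 0 ≤ b i) :
    ∏ i ∈ s, (1 + b i) - 1 - ∑ i ∈ s, b i ≤ (∏ i ∈ s, (1 + b i) - 1) ^ 2 := by
  classical
  have key : (1 + ∑ i ∈ s, b i ≤ ∏ i ∈ s, (1 + b i)) ∧
      (∏ i ∈ s, (1 + b i)) * (1 - ∑ i ∈ s, b i) ≤ 1 ∧ 0 ≤ ∑ i ∈ s, b i := by
    induction s using Finset.induction_on with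
    | empty => simp
    | insert a s ha ih =>
      obtain ⟨h1, h2, h3⟩ := ih fun i hi => hb i (Finset.mem_insert_of_mem hi)
      have h4 := hb a (Finset.mem_insert_self _ _)
      rw [Finset.prod_insert ha, Finset.sum_insert ha]
      set P := ∏ i ∈ s, (1 + b i)
      set t := ∑ i ∈ s, b i
      have hP : 0 ≤ P := by linarith
      refine ⟨by nlinarith, ?_, by linarith⟩
      have : 0 ≤ P * (b a * t + b a ^ 2) := by positivity
      nlinarith
  obtain ⟨h1, h2, h3⟩ := key
  nlinarith

theorem sum_two_le_card {f : Finset ι → ℝ} :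
    ∑ I : Finset ι with 2 ≤ I.card, f I = ∑ I, f I - f ∅ - ∑ i, f {i} := by
  have h1 : ∑ I, f I = ∑ I : Finset ι with 2 ≤ I.card, f I + ∑ I : Finset ι with ¬ 2 ≤ I.card, f I :=
    (Finset.sum_filter_add_sum_filter_not _ _ _).symm
  have h2 : (Finset.univ.filter fun I : Finset ι => ¬ 2 ≤ I.card) =
      insert ∅ (Finset.univ.image fun i : ι => ({i} : Finset ι)) := by
    ext I
    simp only [Finset.mem_filter, Finset.mem_univ, true_and, Finset.mem_insert, Finset.mem_image]
    constructor
    · intro h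
      have : I.card = 0 ∨ I.card = 1 := by omega
      rcases this with h | h
      · exact Or.inl (Finset.card_eq_zero.1 h)
      · obtain ⟨a, rfl⟩ := Finset.card_eq_one.1 h
        exact Or.inr ⟨a, rfl⟩
    · rintro (rfl | ⟨a, rfl⟩) <;> simp
  rw [h1, h2, Finset.sum_insert (by simp), Finset.sum_image (Finset.singleton_injective.injOn)]
  ring

/-- Principal minors of all orders add up to det(1 + B); removing orders 0 and 1 leaves det(1 + B) -
1 - tr B, to which the scalar inequality for the eigenvalues applies. -/
theorem sum_det_mixRows_one_two_le {B : Matrix ι ι ℝ} (hB : B.PosSemidef) :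
    ∑ I : Finset ι with 2 ≤ I.card, (mixRows I B 1).det ≤ ((1 + B).det - 1) ^ 2 := by
  rw [sum_two_le_card, sum_det_mixRows_one]
  have h1 : ∑ i, (mixRows {i} B 1).det = B.trace := by
    refine Finset.sum_congr rfl fun i _ => ?_
    rw [det_mixRows_one]
    have : Unique ({i} : Finset ι) :=
      ⟨⟨⟨i, Finset.mem_singleton_self i⟩⟩, fun x => Subtype.ext (Finset.mem_singleton.1 x.2)⟩
    rw [Matrix.det_unique, Matrix.submatrix_apply,
      Finset.mem_singleton.1 (default : ({i} : Finset ι)).2, Matrix.diag_apply]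
  rw [h1, mixRows_empty, Matrix.det_one, hB.isHermitian.trace_eq_sum_eigenvalues,
    det_one_add_eq_prod hB.isHermitian]
  simpa using prod_one_add_sub_le Finset.univ hB.isHermitian.eigenvalues
    fun i _ => hB.eigenvalues_nonneg i

theorem det_mixRows_eq_mul (M Z : Matrix ι ι ℝ) (hM : IsUnit M.det) (I : Finset ι) :
    (mixRows I Z M).det = (mixRows I (Z * M⁻¹) 1).det * M.det := by
  rw [← Matrix.det_mul]
  congr 1
  ext i j
  by_cases hi : i ∈ I
  · have : (Z * M⁻¹ * M) i j = Z i j := by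
      rw [Matrix.mul_assoc, Matrix.nonsing_inv_mul _ hM, Matrix.mul_one]
    rw [Matrix.mul_apply] at this ⊢
    simp only [mixRows, Matrix.of_apply, hi, if_true, this]
  · have : ((1 : Matrix ι ι ℝ) * M) i j = M i j := by rw [Matrix.one_mul]
    rw [Matrix.mul_apply] at this ⊢
    simp only [mixRows, Matrix.of_apply, hi, if_false, this]

theorem det_gram_eq (M Z : Matrix ι ι ℝ) (hM : IsUnit M.det) :
    (M.transpose * M + Z.transpose * Z).det =
      M.det ^ 2 * (1 + (Z * M⁻¹).transpose * (Z * M⁻¹)).det := by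
  have hZ : Z = Z * M⁻¹ * M := by
    rw [Matrix.mul_assoc, Matrix.nonsing_inv_mul _ hM, Matrix.mul_one]
  have e : M.transpose * M + Z.transpose * Z =
      M.transpose * (1 + (Z * M⁻¹).transpose * (Z * M⁻¹)) * M := by
    conv_lhs => rw [hZ]
    rw [Matrix.transpose_mul (Z * M⁻¹) M]
    simp only [mul_add, add_mul, mul_one, Matrix.mul_assoc]
  rw [e, Matrix.det_mul, Matrix.det_mul, Matrix.det_transpose]
  ring

/-- For invertible M, factor M out on the right: with A = ZM⁻¹ the right side is (det M)² times the
sum of the principal minors of AᵀA, and these dominate the squared principal minors of A. Singular M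
is a limit of M + t·1. -/
theorem sum_sq_minors_le (M Z : Matrix ι ι ℝ) :
    ∑ I : Finset ι, (mixRows I Z M).det ^ 2 ≤
      (M.transpose * M + Z.transpose * Z).det := by
  have hinv : ∀ M : Matrix ι ι ℝ, IsUnit M.det → ∑ I : Finset ι, (mixRows I Z M).det ^ 2 ≤
      (M.transpose * M + Z.transpose * Z).det := by
    intro M hM
    rw [det_gram_eq M Z hM, ← sum_det_mixRows_one, Finset.mul_sum]
    refine Finset.sum_le_sum fun I _ => ?_
    rw [det_mixRows_eq_mul M Z hM, mul_pow, mul_comm]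
    exact mul_le_mul_of_nonneg_left (sq_det_mixRows_le _ _) (sq_nonneg _)
  -- M + t·1 is singular only when t is one of the finitely many eigenvalues of -M.
  have hev : ∀ᶠ t : ℝ in nhdsWithin 0 {0}ᶜ, IsUnit (M + t • (1 : Matrix ι ι ℝ)).det := by
    have hfin : {t : ℝ | ¬ IsUnit (M + t • (1 : Matrix ι ι ℝ)).det}.Finite := by
      refine ((-M).charpoly.rootSet_finite ℝ).subset fun t ht => ?_
      rw [Polynomial.mem_rootSet_of_ne (Matrix.charpoly_monic _).ne_zero]
      simp only [Set.mem_ofPred_eq, isUnit_iff_ne_zero, not_not] at ht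
      rw [Polynomial.aeval_def, Algebra.algebraMap_self, Polynomial.eval₂_id, Matrix.eval_charpoly, ← ht]
      congr 1
      ext i j
      simp [Matrix.scalar_apply, Matrix.diagonal_apply, Matrix.one_apply, add_comm]
    have h2 : (({t : ℝ | ¬ IsUnit (M + t • (1 : Matrix ι ι ℝ)).det} \ {0})ᶜ) ∈ nhds (0:ℝ) :=
      (hfin.subset Set.sdiff_subset).isClosed.isOpen_compl.mem_nhds (by simp)
    filter_upwards [mem_nhdsWithin_of_mem_nhds h2, self_mem_nhdsWithin] with t ht ht0
    by_contra hc
    exact ht ⟨hc, ht0⟩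
  have c1 : Continuous fun t : ℝ => ∑ I : Finset ι,
      (mixRows I Z (M + t • (1 : Matrix ι ι ℝ))).det ^ 2 := by
    refine continuous_finsetSum _ fun I _ => (Continuous.matrix_det ?_).pow 2
    refine continuous_matrix fun i j => ?_
    by_cases hi : i ∈ I
    · simp only [mixRows, Matrix.of_apply, hi, if_true]; fun_prop
    · simp only [mixRows, Matrix.of_apply, hi, if_false]
      exact ((continuous_const.add (continuous_id.smul continuous_const)).matrix_elem i j)
  have c2 : Continuous fun t : ℝ => ((M + t • (1 : Matrix ι ι ℝ)).transpose *
      (M + t • (1 : Matrix ι ι ℝ)) + Z.transpose * Z).det := by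
    refine Continuous.matrix_det ?_
    fun_prop
  have l1 := (c1.tendsto 0).mono_left (nhdsWithin_le_nhds (s := {0}ᶜ))
  have l2 := (c2.tendsto 0).mono_left (nhdsWithin_le_nhds (s := {0}ᶜ))
  simp only [zero_smul, add_zero] at l1 l2
  exact le_of_tendsto_of_tendsto l1 l2 (hev.mono fun t ht => hinv _ ht)

/-- With D = (det M)² and P = det(1 + AᵀA), A = ZM⁻¹, the minors with at least two rows of Z have
total square at most D(P - 1)². The hypothesis reads DP ≤ 1, so D²(P - 1)² ≤ (1 - D)². -/
theorem sq_det_mul_sum_sq_minors_le (M Z : Matrix ι ι ℝ)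
    (h : (M.transpose * M + Z.transpose * Z).det ≤ 1) :
    M.det ^ 2 * ∑ I : Finset ι with 2 ≤ I.card, (mixRows I Z M).det ^ 2 ≤ (1 - M.det ^ 2) ^ 2 := by
  by_cases h0 : M.det = 0
  · simp [h0]
  have hM : IsUnit M.det := isUnit_iff_ne_zero.2 h0
  rw [det_gram_eq M Z hM] at h
  set A := Z * M⁻¹
  have hB : (A.transpose * A).PosSemidef := by
    simpa using Matrix.posSemidef_conjTranspose_mul_self A
  have h1 : ∑ I : Finset ι with 2 ≤ I.card, (mixRows I Z M).det ^ 2 ≤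
      M.det ^ 2 * ((1 + A.transpose * A).det - 1) ^ 2 := by
    refine le_trans ?_ (mul_le_mul_of_nonneg_left (sum_det_mixRows_one_two_le hB) (sq_nonneg _))
    rw [Finset.mul_sum]
    refine Finset.sum_le_sum fun I _ => ?_
    rw [det_mixRows_eq_mul M Z hM, mul_pow, mul_comm]
    exact mul_le_mul_of_nonneg_left (sq_det_mixRows_le _ _) (sq_nonneg _)
  have h2 := one_le_det_one_add hB
  set P := (1 + A.transpose * A).det
  have h3 : 0 ≤ M.det ^ 2 := sq_nonneg _
  set D := M.det ^ 2
  calc _ ≤ D * (D * (P - 1) ^ 2) := mul_le_mul_of_nonneg_left h1 h3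
    _ = (D * P - D) ^ 2 := by ring
    _ ≤ (1 - D) ^ 2 := by
      have : 0 ≤ D * P - D := by nlinarith
      exact pow_le_pow_left₀ this (by linarith) 2

/-- Weights of total square at most `1/16` on the minors involving at least two rows of `Z`. -/
theorem abs_det_add_sum_minors_le_one (M Z : Matrix ι ι ℝ)
    (h : (M.transpose * M + Z.transpose * Z).det ≤ 1) (c : Finset ι → ℝ)
    (hc : ∑ I : Finset ι with 2 ≤ I.card, c I ^ 2 ≤ 1 / 16) :
    |M.det + ∑ I : Finset ι with 2 ≤ I.card, c I * (mixRows I Z M).det| ≤ 1 := by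
  have ha := (sum_sq_minors_le M Z).trans h
  have hb := sq_det_mul_sum_sq_minors_le M Z h
  have hcs := Finset.sum_mul_sq_le_sq_mul_sq (Finset.univ.filter fun I : Finset ι => 2 ≤ I.card) c
    fun I => (mixRows I Z M).det
  set T := ∑ I : Finset ι with 2 ≤ I.card, c I * (mixRows I Z M).det
  set E := ∑ I : Finset ι with 2 ≤ I.card, (mixRows I Z M).det ^ 2
  have hE0 : 0 ≤ E := Finset.sum_nonneg fun _ _ => sq_nonneg _
  have haE : M.det ^ 2 + E ≤ 1 := by
    refine le_trans ?_ ha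
    rw [← Finset.sum_filter_add_sum_filter_not Finset.univ (fun I : Finset ι => 2 ≤ I.card), add_comm]
    refine add_le_add_right ?_ _
    refine le_trans (le_of_eq ?_) (Finset.single_le_sum (fun _ _ => sq_nonneg _)
      (Finset.mem_filter.2 ⟨Finset.mem_univ ∅, by simp⟩))
    rw [mixRows_empty]
  have hT : T ^ 2 ≤ 1 / 16 * E := hcs.trans (mul_le_mul_of_nonneg_right hc hE0)
  refine (abs_add_le _ _).trans ?_
  rw [← sq_abs] at haE hT
  rw [← sq_abs M.det] at hb
  set d := |M.det|
  have hd : 0 ≤ d := abs_nonneg _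
  have ht : 0 ≤ |T| := abs_nonneg _
  set t := |T|
  have hd1 : d ≤ 1 := by nlinarith
  -- For small d, t² ≤ E/16 already gives t ≤ 1/4, while d ≤ 3/4. For d² > 1/2 the second-order
  -- bound gives t² ≤ (1 - d²)²/(16d²) ≤ (1 - d)².
  by_cases hd2 : d ^ 2 ≤ 1 / 2
  · have h1 : t ≤ 1 / 4 := by nlinarith
    have h2 : d ≤ 3 / 4 := by nlinarith
    linarith
  · push Not at hd2
    have h1 : t ^ 2 ≤ (1 - d) ^ 2 := by
      have h2 : d ^ 2 * t ^ 2 ≤ 1 / 16 * (1 - d ^ 2) ^ 2 := by nlinarith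
      have h3 : (1 - d ^ 2) ^ 2 ≤ 4 * (1 - d) ^ 2 := by
        have : 1 - d ^ 2 ≤ 2 * (1 - d) := by nlinarith
        have h5 : 0 ≤ 1 - d ^ 2 := by nlinarith
        nlinarith
      nlinarith [sq_nonneg t]
    have := abs_le_of_sq_le_sq h1 (by linarith)
    linarith [le_abs_self t]

end Minors

/-! ### The total square of the weights -/

section Weights

variable {ι : Type*} [Fintype ι] [DecidableEq ι]

/-- At most one index a can have l_a² > q; it is paired with another index b of I, and (l_a l_b)² ≤
q² pays for both. -/
theorem prod_sq_le_pow (l : ι → ℝ) (q : ℝ) (hl : ∀ i, 0 ≤ l i)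
    (h : ∀ i j, i ≠ j → l i * l j ≤ q) (I : Finset ι) (hI : 2 ≤ I.card) :
    (∏ i ∈ I, l i) ^ 2 ≤ q ^ I.card := by
  have hq : 0 ≤ q := by
    obtain ⟨a, -, b, -, hab⟩ := Finset.one_lt_card.1 hI
    exact (mul_nonneg (hl a) (hl b)).trans (h a b hab)
  rw [← Finset.prod_pow]
  by_cases hall : ∀ i ∈ I, l i ^ 2 ≤ q
  · exact (Finset.prod_le_prod (fun i _ => sq_nonneg _) hall).trans (by simp)
  push Not at hall
  obtain ⟨a, ha, haq⟩ := hall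
  have hoth : ∀ j, j ≠ a → l j ^ 2 ≤ q := by
    intro j hj
    have h1 := h a j hj.symm
    have h2 := mul_nonneg (hl a) (hl j)
    by_contra hc
    push Not at hc
    have : (l a * l j) ^ 2 ≤ q ^ 2 := pow_le_pow_left₀ h2 h1 2
    rw [mul_pow] at this
    nlinarith
  obtain ⟨b, hb⟩ : (I.erase a).Nonempty := by
    rw [← Finset.card_pos, Finset.card_erase_of_mem ha]; omega
  rw [← Finset.mul_prod_erase I _ ha, ← Finset.mul_prod_erase (I.erase a) _ hb, ← mul_assoc]
  have hcard : I.card = 2 + ((I.erase a).erase b).card := by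
    rw [Finset.card_erase_of_mem hb, Finset.card_erase_of_mem ha]; omega
  rw [hcard, pow_add]
  have hba : b ≠ a := Finset.ne_of_mem_erase hb
  refine mul_le_mul ?_ ?_ (Finset.prod_nonneg fun i _ => sq_nonneg _) (by positivity)
  · rw [← mul_pow]
    exact pow_le_pow_left₀ (mul_nonneg (hl a) (hl b)) (h a b hba.symm) 2
  · refine (Finset.prod_le_prod (fun i _ => sq_nonneg _) fun i hi => hoth i ?_).trans
      (by rw [Finset.prod_const])
    exact Finset.ne_of_mem_erase (Finset.mem_of_mem_erase hi)

theorem sq_sub_one_le_two_pow (k : ℕ) (hk : 2 ≤ k) : ((k : ℝ) - 1) ^ 2 ≤ 2 ^ k := by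
  induction k, hk using Nat.le_induction with
  | base => norm_num
  | succ k hk ih =>
    rcases Nat.lt_or_ge k 4 with h | h
    · interval_cases k <;> norm_num
    · have : (4 : ℝ) ≤ k := by exact_mod_cast h
      push_cast
      rw [pow_succ 2 k]
      nlinarith

/-- Only subsets of s contribute, each at most (2q)^{|I|} because (k - 1)² ≤ 2^k. Summing over all
nonempty subsets of s gives (1 + 2q)^{|s|} - 1, so only the product of q and |s| has to be small. -/
theorem sum_weights_le (l : ι → ℝ) (q : ℝ) (hl : ∀ i, 0 ≤ l i)
    (h : ∀ i j, i ≠ j → l i * l j ≤ q) (s : Finset ι) (hs : ∀ i, i ∉ s → l i = 0) (hq : 0 ≤ q)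
    (hqs : q * s.card ≤ 1 / 50) :
    ∑ I : Finset ι with 2 ≤ I.card, ((-1) ^ I.card * (1 - (I.card : ℝ)) * ∏ i ∈ I, l i) ^ 2 ≤ 1 / 16 := by
  have h1 : ∀ I : Finset ι, 2 ≤ I.card → I ∈ s.powerset →
      ((-1) ^ I.card * (1 - (I.card : ℝ)) * ∏ i ∈ I, l i) ^ 2 ≤ ∏ i ∈ I, (2 * q) := by
    intro I hI _
    rw [Finset.prod_const, mul_pow 2 q, mul_pow, mul_pow, ← pow_mul, mul_comm I.card 2, pow_mul,
      neg_one_sq, one_pow, one_mul]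
    refine mul_le_mul ?_ (prod_sq_le_pow l q hl h I hI) (sq_nonneg _) (by positivity)
    have := sq_sub_one_le_two_pow I.card hI
    nlinarith
  have h2 : ∀ I : Finset ι, I ∉ s.powerset →
      ((-1) ^ I.card * (1 - (I.card : ℝ)) * ∏ i ∈ I, l i) ^ 2 = 0 := by
    intro I hI
    rw [Finset.mem_powerset, Finset.not_subset] at hI
    obtain ⟨i, hi, his⟩ := hI
    rw [Finset.prod_eq_zero hi (hs i his)]
    simp
  calc ∑ I : Finset ι with 2 ≤ I.card, ((-1) ^ I.card * (1 - (I.card : ℝ)) * ∏ i ∈ I, l i) ^ 2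
      ≤ ∑ I ∈ s.powerset.erase ∅, ∏ i ∈ I, (2 * q) := by
        have hnn : ∀ I : Finset ι, 0 ≤ ∏ i ∈ I, (2 * q) :=
          fun I => Finset.prod_nonneg fun _ _ => by positivity
        rw [Finset.sum_filter, ← Finset.sum_subset (Finset.subset_univ (s.powerset.erase ∅))]
        · refine Finset.sum_le_sum fun I hI => ?_
          split_ifs with hc
          · exact h1 I hc (Finset.mem_of_mem_erase hI)
          · exact hnn I
        · intro I _ hI
          split_ifs with hc
          · refine h2 I fun hIs => hI (Finset.mem_erase.2 ⟨?_, hIs⟩)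
            rintro rfl
            simp at hc
          · rfl
    _ = (1 + 2 * q) ^ s.card - 1 := by
        rw [Finset.sum_erase_eq_sub (Finset.empty_mem_powerset s), ← Finset.prod_one_add]
        simp
    _ ≤ Real.exp (2 * q * s.card) - 1 := by
        have : (1 + 2 * q) ^ s.card ≤ (Real.exp (2 * q)) ^ s.card := by
          refine pow_le_pow_left₀ (by positivity) ?_ _
          linarith [Real.add_one_le_exp (2 * q)]
        rw [← Real.exp_nat_mul, mul_comm (s.card : ℝ)] at this
        linarith
    -- The exponent is at most 1/25, and eˣ ≤ 1/(1 - x) gives 25/24 < 17/16.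
    _ ≤ 1 / 16 := by
        have h3 : 0 ≤ 2 * q * s.card := by positivity
        have := Real.exp_bound_div_one_sub_of_interval h3 (by linarith)
        have h4 : 1 / (1 - 2 * q * s.card) ≤ 17 / 16 := by
          rw [div_le_div_iff₀ (by linarith) (by norm_num)]
          linarith
        linarith

end Weights

/-! ### The functional f(1) - f'(1) for f(t) = det(M - tN) -/

section Polarization

variable {ι : Type*} [Fintype ι] [DecidableEq ι]

/-- `f 1 - f' 1`, where `f t = det (M - t N)`, expanded over the sets of rows taken from `N`. -/
def thetaDet (M N : Matrix ι ι ℝ) : ℝ :=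
  ∑ I : Finset ι, (-1) ^ I.card * (1 - (I.card : ℝ)) * (mixRows I N M).det

theorem det_mixRows_smul (I : Finset ι) (c : ℝ) (M N : Matrix ι ι ℝ) :
    (mixRows I (c • N) M).det = c ^ I.card * (mixRows I N M).det := by
  have := Matrix.det_mul_column (fun i => if i ∈ I then c else 1) (mixRows I N M)
  rw [Finset.prod_ite_mem, Finset.univ_inter, Finset.prod_const] at this
  rw [← this]
  congr 1
  ext i j
  by_cases hi : i ∈ I <;> simp [mixRows, hi]

theorem det_mixRows_diagonal_mul (I : Finset ι) (l : ι → ℝ) (M N : Matrix ι ι ℝ) :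
    (mixRows I (Matrix.diagonal l * N) M).det = (∏ i ∈ I, l i) * (mixRows I N M).det := by
  have := Matrix.det_mul_column (fun i => if i ∈ I then l i else 1) (mixRows I N M)
  rw [Finset.prod_ite_mem, Finset.univ_inter] at this
  rw [← this]
  congr 1
  ext i j
  by_cases hi : i ∈ I <;> simp [mixRows, hi]

theorem det_sub_smul_eq_sum (M N : Matrix ι ι ℝ) (t : ℝ) :
    (M - t • N).det = ∑ I : Finset ι, (-t) ^ I.card * (mixRows I N M).det := by
  rw [sub_eq_neg_add, ← neg_smul, det_add_eq_sum_mixRows]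
  simp_rw [det_mixRows_smul]

theorem hasDerivAt_det_sub_smul (M N : Matrix ι ι ℝ) (t : ℝ) :
    HasDerivAt (fun t : ℝ => (M - t • N).det)
      (∑ I : Finset ι, -((I.card : ℝ) * (-t) ^ (I.card - 1)) * (mixRows I N M).det) t := by
  simp_rw [det_sub_smul_eq_sum]
  refine HasDerivAt.fun_sum fun I _ => HasDerivAt.mul_const ?_ _
  simpa using (hasDerivAt_neg t).fun_pow I.card

theorem thetaDet_eq {M N : Matrix ι ι ℝ} {f' : ℝ}
    (h : HasDerivAt (fun t : ℝ => (M - t • N).det) f' 1) :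
    thetaDet M N = (M - N).det - f' := by
  rw [h.unique (hasDerivAt_det_sub_smul M N 1)]
  have := det_sub_smul_eq_sum M N 1
  rw [one_smul] at this
  rw [this, ← Finset.sum_sub_distrib, thetaDet]
  refine Finset.sum_congr rfl fun I _ => ?_
  rcases Nat.eq_zero_or_pos I.card with h | h
  · simp [h]
  · obtain ⟨k, hk⟩ := Nat.exists_eq_succ_of_ne_zero h.ne'
    rw [hk, Nat.succ_sub_one, pow_succ]
    push_cast
    ring

/-- The functional depends only on the polynomial det(M - tN), and linearly. This gives its
invariance under transposition and its behaviour under orthogonal changes of basis. -/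
theorem thetaDet_congr {M N M' N' : Matrix ι ι ℝ} {c : ℝ}
    (h : ∀ t : ℝ, (M - t • N).det = c * (M' - t • N').det) :
    thetaDet M N = c * thetaDet M' N' := by
  have h1 := (hasDerivAt_det_sub_smul M' N' 1).const_mul c
  rw [thetaDet_eq (hasDerivAt_det_sub_smul M' N' 1),
    thetaDet_eq (h1.congr_of_eventuallyEq (Filter.Eventually.of_forall h)), mul_sub]
  have := h 1
  rw [one_smul, one_smul] at this
  rw [this]

theorem thetaDet_transpose (M N : Matrix ι ι ℝ) :
    thetaDet M.transpose N.transpose = thetaDet M N := by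
  rw [thetaDet_congr (c := 1) (M' := M) (N' := N), one_mul]
  intro t
  rw [one_mul, ← Matrix.det_transpose (M - t • N), Matrix.transpose_sub, Matrix.transpose_smul]

/-- The linearization of `thetaDet` at a factorization `M - s N = C (X - (s - 1) B)`. -/
theorem thetaDet_eq_of_factor {M N C X B : Matrix ι ι ℝ} (h1 : M - N = C * X) (h2 : N = C * B) :
    thetaDet M N = C.det * (X.det + ∑ i, (mixRows {i} B X).det) := by
  have hf : ∀ t : ℝ, (M - t • N).det = C.det * (X - (t - 1) • B).det := by
    intro t
    rw [← Matrix.det_mul]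
    congr 1
    rw [mul_sub, ← h1, Matrix.mul_smul, ← h2, sub_smul, one_smul]
    abel
  have hd : HasDerivAt (fun t : ℝ => (X - (t - 1) • B).det)
      (∑ I : Finset ι, -((I.card : ℝ) * (-(1 - 1 : ℝ)) ^ (I.card - 1)) * (mixRows I B X).det) 1 := by
    have := HasDerivAt.comp_sub_const (1 : ℝ) 1 (hasDerivAt_det_sub_smul X B (1 - 1))
    exact this
  have h3 := hd.const_mul C.det
  rw [thetaDet_eq (h3.congr_of_eventuallyEq (Filter.Eventually.of_forall hf)), h1, Matrix.det_mul,
    ← mul_sub]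
  congr 1
  rw [sub_eq_add_neg, ← Finset.sum_neg_distrib]
  congr 1
  -- The derivative is taken where t - 1 = 0, so the power 0^{|I|-1} removes all |I| ≥ 2; for I = ∅
  -- the truncated exponent is 0, but the factor |I| vanishes.
  rw [← Finset.sum_image (s := Finset.univ) (g := fun i : ι => ({i} : Finset ι))
    (f := fun I => (mixRows I B X).det) (Finset.singleton_injective.injOn)]
  rw [← Finset.sum_subset (Finset.subset_univ (Finset.univ.image fun i : ι => ({i} : Finset ι)))]
  · refine Finset.sum_congr rfl fun I hI => ?_
    obtain ⟨i, -, rfl⟩ := Finset.mem_image.1 hI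
    simp
  · intro I _ hI
    have hI1 : I.card ≠ 1 := by
      intro hc
      obtain ⟨a, rfl⟩ := Finset.card_eq_one.1 hc
      exact hI (Finset.mem_image_of_mem _ (Finset.mem_univ a))
    rcases Nat.eq_zero_or_pos I.card with h | h
    · simp [h]
    · have : I.card - 1 ≠ 0 := by omega
      simp [this]

end Polarization

variable {n m : ℕ}

/-! ### The iterates of `Ψ` -/

/-- The transpose of `J`, `v ↦ ∑ ⟨J e_i, v⟩ e_i`. -/
def normalToTangent (S : Matrix (Fin m) (Fin n) ℝ) (v : Amb n m) : Amb n m :=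
  ∑ i, (inner ℝ (tangentToNormal S (tangentFrame S i)) v : ℝ) • tangentFrame S i

/-- Ψ acts as the derivation induced by the transpose of J: expand Jᵀvⱼ in the frame and move the
inserted vector to the first slot. -/
theorem Psi_apply (S : Matrix (Fin m) (Fin n) ℝ) {k : ℕ} (ξ : Amb n m [⋀^Fin k]→L[ℝ] ℝ)
    (v : Fin k → Amb n m) :
    Psi S ξ v = ∑ j, ξ (Function.update v j (normalToTangent S (v j))) := by
  cases k with
  | zero => simp [Psi]
  | succ k =>
    have h : ∀ j : Fin (k + 1), ξ (Function.update v j (normalToTangent S (v j))) =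
        ∑ i, (-1) ^ (j : ℕ) * ((inner ℝ (tangentToNormal S (tangentFrame S i)) (v j) : ℝ) *
          ξ (Matrix.vecCons (tangentFrame S i) (j.removeNth v))) := by
      intro j
      rw [normalToTangent]
      refine (ξ.toMultilinearMap.map_update_sum _ j _ v).trans ?_
      refine Finset.sum_congr rfl fun i _ => ?_
      refine (ContinuousAlternatingMap.map_update_smul ξ v j _ _).trans ?_
      rw [← Fin.insertNth_removeNth,
        ContinuousAlternatingMap.map_insertNth]
      simp only [smul_eq_mul]
      ring
    simp_rw [h]
    rw [Finset.sum_comm, Psi, ContinuousAlternatingMap.sum_apply]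
    refine Finset.sum_congr rfl fun i _ => ?_
    rw [wedgeOne, ContinuousAlternatingMap.alternatizeUncurryFin_apply]
    refine Finset.sum_congr rfl fun j _ => ?_
    simp [interiorMul]

theorem inner_tangentIso_normalIso (S : Matrix (Fin m) (Fin n) ℝ) (u : E n) (w : E m) :
    inner ℝ (tangentIso S u) (normalIso S w) = 0 := by
  rw [tangentIso, normalIso, pairMap_apply, pairMap_apply]
  simp only [WithLp.prod_inner_apply, EuclideanSpace.inner_eq_star_dotProduct, star_trivial]
  rw [Matrix.neg_mulVec, neg_dotProduct, ← Matrix.mulVec_mulVec, ← Matrix.mulVec_mulVec,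
    Matrix.dotProduct_mulVec _ S, ← Matrix.mulVec_transpose]
  simp

theorem normalToTangent_tangentFrame (S : Matrix (Fin m) (Fin n) ℝ) (i : Fin n) :
    normalToTangent S (tangentFrame S i) = 0 := by
  refine Finset.sum_eq_zero fun j _ => ?_
  rw [real_inner_comm, tangentFrame, tangentFrame, tangentToNormal]
  simp only [ContinuousLinearMap.coe_comp, Function.comp_apply]
  rw [inner_tangentIso_normalIso, zero_smul]

/-- The transpose of J takes tangent values and kills tangent vectors, because every J eᵢ is normal.
-/
theorem normalToTangent_normalToTangent (S : Matrix (Fin m) (Fin n) ℝ) (v : Amb n m) :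
    normalToTangent S (normalToTangent S v) = 0 := by
  have h : ∀ c : Fin n → ℝ, normalToTangent S (∑ i, c i • tangentFrame S i) =
      ∑ i, c i • normalToTangent S (tangentFrame S i) := by
    intro c
    simp only [normalToTangent, inner_sum, inner_smul_right, Finset.sum_smul, Finset.smul_sum,
      mul_smul]
    exact Finset.sum_comm
  conv_lhs => rw [normalToTangent.eq_1 S v]
  rw [h]
  simp [normalToTangent_tangentFrame]

/-- Double counting: a set of size l + 1 arises from l + 1 choices of the inserted element. -/
theorem sum_sum_insert {ι : Type*} [Fintype ι] [DecidableEq ι] (h : Finset ι → ℝ) (l : ℕ) :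
    ∑ j, ∑ I ∈ Finset.powersetCard l Finset.univ, (if j ∈ I then 0 else h (insert j I)) =
      ((l : ℝ) + 1) * ∑ I ∈ Finset.powersetCard (l + 1) Finset.univ, h I := by
  have h1 : ∀ j, ∑ I ∈ Finset.powersetCard l Finset.univ, (if j ∈ I then 0 else h (insert j I)) =
      ∑ I ∈ Finset.powersetCard (l + 1) Finset.univ, (if j ∈ I then h I else 0) := by
    intro j
    rw [Finset.sum_ite, Finset.sum_const_zero, zero_add, ← Finset.sum_filter]
    refine Finset.sum_bij' (fun I _ => insert j I) (fun I _ => I.erase j) ?_ ?_ ?_ ?_ ?_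
    · intro I hI
      simp only [Finset.mem_filter, Finset.mem_powersetCard_univ] at hI ⊢
      exact ⟨by rw [Finset.card_insert_of_notMem hI.2, hI.1], Finset.mem_insert_self _ _⟩
    · intro I hI
      simp only [Finset.mem_filter, Finset.mem_powersetCard_univ] at hI ⊢
      exact ⟨by rw [Finset.card_erase_of_mem hI.2, hI.1]; rfl, Finset.notMem_erase _ _⟩
    · intro I hI
      exact Finset.erase_insert (Finset.mem_filter.1 hI).2
    · intro I hI
      exact Finset.insert_erase (Finset.mem_filter.1 hI).2
    · intros; rfl
  simp_rw [h1]
  rw [Finset.sum_comm, Finset.mul_sum]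
  refine Finset.sum_congr rfl fun I hI => ?_
  rw [← Finset.sum_filter, Finset.sum_const, Finset.filter_mem_eq_inter, Finset.univ_inter,
    Finset.mem_powersetCard_univ.1 hI, nsmul_eq_mul]
  push_cast
  ring

/-- Applying Jᵀ twice in one slot gives zero, so the surviving terms use l distinct slots, each set
of slots being reached in l! orders. -/
theorem Psi_iterate_apply (S : Matrix (Fin m) (Fin n) ℝ) {k : ℕ} (ξ : Amb n m [⋀^Fin k]→L[ℝ] ℝ)
    (l : ℕ) (v : Fin k → Amb n m) :
    (Psi S)^[l] ξ v = (l.factorial : ℝ) * ∑ I ∈ Finset.powersetCard l Finset.univ,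
      ξ (I.piecewise (fun j => normalToTangent S (v j)) v) := by
  induction l generalizing v with
  | zero => simp
  | succ l ih =>
    rw [Function.iterate_succ_apply', Psi_apply]
    simp_rw [ih]
    rw [← Finset.mul_sum, Nat.factorial_succ]
    push_cast
    rw [mul_comm ((l : ℝ) + 1), mul_assoc, ← sum_sum_insert]
    congr 1
    refine Finset.sum_congr rfl fun j _ => Finset.sum_congr rfl fun I _ => ?_
    split_ifs with hj
    · refine ξ.toAlternatingMap.map_coord_zero j ?_
      simp [hj, normalToTangent_normalToTangent]
    · congr 1
      ext1 i
      by_cases hij : i = j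
      · subst hij; simp [hj]
      · by_cases hi : i ∈ I <;> simp [hi, hij]

theorem thetaCovector_apply (S : Matrix (Fin m) (Fin n) ℝ) (v : Fin n → Amb n m) :
    thetaCovector S v = ∑ I : Finset (Fin n), (-1) ^ I.card * (1 - (I.card : ℝ)) *
      volForm S (I.piecewise (fun j => normalToTangent S (v j)) v) := by
  rw [← Finset.powerset_univ, Finset.sum_powerset, Finset.card_univ, Fintype.card_fin,
    Finset.range_eq_Ico, Finset.sum_eq_sum_Ico_succ_bot (Nat.succ_pos n)]
  have : Finset.Ico (0 + 1) (n + 1) = Finset.Icc 1 n := by ext; simp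
  rw [this, thetaCovector, ContinuousAlternatingMap.sub_apply, ContinuousAlternatingMap.sum_apply,
    sub_eq_add_neg, ← Finset.sum_neg_distrib]
  congr 1
  · simp
  · refine Finset.sum_congr rfl fun l _ => ?_
    rw [ContinuousAlternatingMap.smul_apply, Psi_iterate_apply, smul_eq_mul]
    have hl : (l.factorial : ℝ) ≠ 0 := by exact_mod_cast l.factorial_ne_zero
    rw [← mul_assoc, div_mul_cancel₀ _ hl, ← neg_mul, Finset.mul_sum]
    refine Finset.sum_congr rfl fun I hI => ?_
    rw [Finset.mem_powersetCard_univ.1 hI]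
    ring

theorem thetaCovector_eq_thetaDet (S : Matrix (Fin m) (Fin n) ℝ) (v : Fin n → Amb n m) :
    thetaCovector S v = thetaDet
      (Matrix.of fun i j => (inner ℝ (tangentFrame S i) (v j) : ℝ))
      (Matrix.of fun i j => (inner ℝ (tangentToNormal S (tangentFrame S i)) (v j) : ℝ)) := by
  -- Replacing vectors of the frame changes columns, whereas `mixRows` changes rows.
  rw [thetaCovector_apply, ← thetaDet_transpose, thetaDet]
  refine Finset.sum_congr rfl fun I _ => ?_
  congr 1
  rw [volForm_apply, ← Matrix.det_transpose]
  congr 1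
  ext j i
  by_cases hj : j ∈ I
  · simp only [Matrix.transpose_apply, Matrix.of_apply, Finset.piecewise_eq_of_mem _ _ _ hj, mixRows,
      hj, if_true, normalToTangent, inner_sum, inner_smul_right,
      orthonormal_iff_ite.1 (tangentFrame_orthonormal S)]
    simp
  · simp [hj, mixRows]

/-! ### The inverse square roots of `G` and `H` -/

theorem matH_eq (S : Matrix (Fin m) (Fin n) ℝ) : matH S = matG S.transpose := by
  rw [matH, matG, Matrix.transpose_transpose]

theorem matH_posDef (S : Matrix (Fin m) (Fin n) ℝ) : (matH S).PosDef :=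
  matH_eq S ▸ matG_posDef S.transpose

theorem invSqrt_posDef {A : Matrix (Fin n) (Fin n) ℝ} (hA : A.PosDef) : (invSqrt A).PosDef := by
  have h1 : (invSqrt A).PosSemidef := by
    open scoped MatrixOrder in
    exact Matrix.nonneg_iff_posSemidef.1 (cfc_nonneg fun t _ => inv_nonneg.2 (Real.sqrt_nonneg t))
  rw [h1.posDef_iff_det_ne_zero]
  intro h0
  have := congrArg Matrix.det (invSqrt_mul hA)
  rw [Matrix.det_mul, h0, mul_zero, Matrix.det_one] at this
  exact zero_ne_one this

theorem invSqrt_mul_self {A : Matrix (Fin n) (Fin n) ℝ} (hA : A.PosDef) :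
    invSqrt A * invSqrt A = A⁻¹ := by
  have h := invSqrt_mul hA
  rw [Matrix.mul_assoc] at h
  have h2 := mul_eq_one_comm.1 h
  rw [Matrix.mul_assoc] at h2
  exact (Matrix.inv_eq_right_inv h2).symm

/-- The product A^{-1/2}A plays the role of A^{1/2}. -/
theorem det_invSqrt_mul {A : Matrix (Fin n) (Fin n) ℝ} (hA : A.PosDef) :
    (invSqrt A * A).det = Real.sqrt A.det := by
  have h := congrArg Matrix.det (invSqrt_mul hA)
  rw [Matrix.det_mul, Matrix.det_mul, Matrix.det_one] at h
  have hR := (invSqrt_posDef hA).det_pos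
  have hA' := hA.det_pos
  rw [Matrix.det_mul]
  rw [← Real.sqrt_sq (mul_pos hR hA').le]
  congr 1
  linear_combination A.det * h

/-- Multiplying by W* and taking the trace gives tr(W*PW) + tr(WQW*) = 0 with both terms
nonnegative; P being definite, W = 0. -/
theorem eq_zero_of_mul_add_mul_eq_zero {P : Matrix (Fin n) (Fin n) ℝ} {Q : Matrix (Fin m) (Fin m) ℝ}
    (hP : P.PosDef) (hQ : Q.PosDef) {W : Matrix (Fin n) (Fin m) ℝ} (h : P * W + W * Q = 0) :
    W = 0 := by
  have h1 := hP.posSemidef.conjTranspose_mul_mul_same W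
  have h2 := hQ.posSemidef.mul_mul_conjTranspose_same W
  have h3 : (W.conjTranspose * P * W).trace + (W * Q * W.conjTranspose).trace = 0 := by
    rw [Matrix.trace_mul_comm (W * Q), Matrix.mul_assoc, ← Matrix.trace_add,
      ← Matrix.mul_add, h, Matrix.mul_zero, Matrix.trace_zero]
  have h4 : (W.conjTranspose * P * W).trace = 0 :=
    le_antisymm (by linarith [h2.trace_nonneg]) h1.trace_nonneg
  rw [h1.trace_eq_zero_iff] at h4
  ext i j
  have h5 : star (W.col j) ⬝ᵥ (P.mulVec (W.col j)) = 0 := by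
    have := congrFun (congrFun h4 j) j
    rw [Matrix.mul_assoc, Matrix.mul_apply] at this
    simpa [dotProduct, Matrix.mul_apply, Matrix.mulVec] using this
  by_contra hne
  have hcol : W.col j ≠ 0 := fun h0 => hne (congrFun h0 i)
  exact (hP.dotProduct_mulVec_pos hcol).ne' h5

theorem matG_mul_transpose (S : Matrix (Fin m) (Fin n) ℝ) :
    matG S * S.transpose = S.transpose * matH S := by
  rw [matG, matH, Matrix.add_mul, Matrix.mul_add, Matrix.one_mul, Matrix.mul_one, Matrix.mul_assoc]

theorem inv_matG_mul_matG (S : Matrix (Fin m) (Fin n) ℝ) : (matG S)⁻¹ * matG S = 1 :=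
  Matrix.nonsing_inv_mul _ (matG_posDef S).det_pos.ne'.isUnit

theorem inv_matH_mul_matH (S : Matrix (Fin m) (Fin n) ℝ) : (matH S)⁻¹ * matH S = 1 :=
  Matrix.nonsing_inv_mul _ (matH_posDef S).det_pos.ne'.isUnit

theorem inv_matG_mul_transpose (S : Matrix (Fin m) (Fin n) ℝ) :
    (matG S)⁻¹ * S.transpose = S.transpose * (matH S)⁻¹ := by
  have h1 : matH S * (matH S)⁻¹ = 1 := mul_eq_one_comm.1 (inv_matH_mul_matH S)
  calc (matG S)⁻¹ * S.transpose = (matG S)⁻¹ * (S.transpose * matH S) * (matH S)⁻¹ := by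
        rw [Matrix.mul_assoc, Matrix.mul_assoc, h1, Matrix.mul_one]
    _ = S.transpose * (matH S)⁻¹ := by
        rw [← matG_mul_transpose, ← Matrix.mul_assoc, inv_matG_mul_matG, Matrix.one_mul]

/-- The difference W of the two sides satisfies G^{-1/2}W + WH^{-1/2} = G⁻¹Sᵀ - SᵀH⁻¹ = 0, so the
Sylvester argument applies. -/
theorem invSqrt_matG_mul_transpose (S : Matrix (Fin m) (Fin n) ℝ) :
    invSqrt (matG S) * S.transpose = S.transpose * invSqrt (matH S) := by
  refine sub_eq_zero.1 (eq_zero_of_mul_add_mul_eq_zero (invSqrt_posDef (matG_posDef S))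
    (invSqrt_posDef (matH_posDef S)) ?_)
  rw [Matrix.mul_sub, Matrix.sub_mul, ← Matrix.mul_assoc, ← Matrix.mul_assoc,
    invSqrt_mul_self (matG_posDef S), Matrix.mul_assoc S.transpose,
    invSqrt_mul_self (matH_posDef S), inv_matG_mul_transpose]
  abel

/-! ### Coordinates of a frame -/

/-- The components along `ℝⁿ` of a tuple of vectors, as columns. -/
def coordX {k : ℕ} (v : Fin k → Amb n m) : Matrix (Fin n) (Fin k) ℝ :=
  Matrix.of fun i j => (v j).fst i

/-- The components along `ℝᵐ` of a tuple of vectors, as columns. -/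
def coordY {k : ℕ} (v : Fin k → Amb n m) : Matrix (Fin m) (Fin k) ℝ :=
  Matrix.of fun i j => (v j).snd i

theorem inner_pairMap_single {k l : ℕ} (A : Matrix (Fin n) (Fin k) ℝ) (B : Matrix (Fin m) (Fin k) ℝ)
    (v : Fin l → Amb n m) :
    (Matrix.of fun i j => (inner ℝ (pairMap A B (EuclideanSpace.single i 1)) (v j) : ℝ)) =
      A.transpose * coordX v + B.transpose * coordY v := by
  ext i j
  rw [Matrix.of_apply, pairMap_apply]
  simp only [WithLp.prod_inner_apply, EuclideanSpace.inner_eq_star_dotProduct, star_trivial]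
  simp [Matrix.mul_apply, coordX, coordY, dotProduct, mul_comm]

theorem inner_tangentFrame (S : Matrix (Fin m) (Fin n) ℝ) {l : ℕ} (v : Fin l → Amb n m) :
    (Matrix.of fun i j => (inner ℝ (tangentFrame S i) (v j) : ℝ)) =
      invSqrt (matG S) * (coordX v + S.transpose * coordY v) := by
  simp_rw [tangentFrame, tangentIso]
  rw [inner_pairMap_single, invSqrt_transpose, Matrix.transpose_mul, invSqrt_transpose,
    Matrix.mul_add, Matrix.mul_assoc]

theorem tangentToNormal_tangentFrame (S : Matrix (Fin m) (Fin n) ℝ) (i : Fin n) :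
    tangentToNormal S (tangentFrame S i) =
      pairMap (-(S.transpose * invSqrt (matH S) * S)) (invSqrt (matH S) * S)
        (EuclideanSpace.single i 1) := by
  rw [tangentToNormal, tangentFrame]
  simp only [ContinuousLinearMap.coe_comp, Function.comp_apply]
  rw [tangentIso_adjoint_apply, normalIso, pairMap_apply, pairMap_apply]
  simp only [Matrix.neg_mulVec, ← Matrix.mulVec_mulVec]
  rfl

theorem inner_tangentToNormal (S : Matrix (Fin m) (Fin n) ℝ) {l : ℕ} (v : Fin l → Amb n m) :
    (Matrix.of fun i j => (inner ℝ (tangentToNormal S (tangentFrame S i)) (v j) : ℝ)) =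
      S.transpose * (invSqrt (matH S) * (coordY v - S * coordX v)) := by
  simp_rw [tangentToNormal_tangentFrame]
  rw [inner_pairMap_single, Matrix.transpose_neg, Matrix.transpose_mul, Matrix.transpose_mul,
    Matrix.transpose_mul, invSqrt_transpose, Matrix.transpose_transpose]
  simp only [Matrix.mul_sub, Matrix.mul_assoc, Matrix.neg_mul]
  abel

theorem transpose_coord_of_orthonormal {l : ℕ} {v : Fin l → Amb n m} (hv : Orthonormal ℝ v) :
    (coordX v).transpose * coordX v + (coordY v).transpose * coordY v = 1 := by
  ext i j
  have := orthonormal_iff_ite.1 hv i j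
  rw [WithLp.prod_inner_apply] at this
  simp only [EuclideanSpace.inner_eq_star_dotProduct, star_trivial] at this
  rw [Matrix.one_apply, ← this, Matrix.add_apply, Matrix.mul_apply, Matrix.mul_apply]
  simp [coordX, coordY, dotProduct, mul_comm]

/-- Passing from (X, Y) to tangential and normal coordinates along the graph is an isometry, so Gram
matrices are preserved. -/
theorem gram_eq_one (S : Matrix (Fin m) (Fin n) ℝ) {X : Matrix (Fin n) (Fin n) ℝ}
    {Y : Matrix (Fin m) (Fin n) ℝ} (h : X.transpose * X + Y.transpose * Y = 1) :
    (invSqrt (matG S) * (X + S.transpose * Y)).transpose *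
        (invSqrt (matG S) * (X + S.transpose * Y)) +
      (invSqrt (matH S) * (Y - S * X)).transpose * (invSqrt (matH S) * (Y - S * X)) = 1 := by
  have e1 : ∀ {k : ℕ} {A : Matrix (Fin k) (Fin k) ℝ} (_ : A.PosDef) (B : Matrix (Fin k) (Fin n) ℝ),
      (invSqrt A * B).transpose * (invSqrt A * B) = B.transpose * (A⁻¹ * B) := by
    intro k A hA B
    rw [Matrix.transpose_mul, invSqrt_transpose, ← invSqrt_mul_self hA]
    simp only [Matrix.mul_assoc]
  rw [e1 (matG_posDef S), e1 (matH_posDef S)]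
  have hg : (matG S)⁻¹ + (matG S)⁻¹ * (S.transpose * S) = 1 := by
    have := inv_matG_mul_matG S
    rwa [matG, mul_add, mul_one, ← matG] at this
  have hh : (matH S)⁻¹ + (matH S)⁻¹ * (S * S.transpose) = 1 := by
    have := inv_matH_mul_matH S
    rwa [matH, mul_add, mul_one, ← matH] at this
  have hgs := inv_matG_mul_transpose S
  have hsg : (matH S)⁻¹ * S = S * (matG S)⁻¹ := by
    have := congrArg Matrix.transpose hgs
    rwa [Matrix.transpose_mul, Matrix.transpose_mul, Matrix.transpose_transpose,
      Matrix.transpose_nonsing_inv, Matrix.transpose_nonsing_inv,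
      show (matG S).transpose = matG S from (matG_posDef S).isHermitian,
      show (matH S).transpose = matH S from (matH_posDef S).isHermitian, eq_comm] at this
  set g := (matG S)⁻¹
  set k := (matH S)⁻¹
  have t1 : g * (X + S.transpose * Y) = g * X + S.transpose * (k * Y) := by
    rw [Matrix.mul_add, ← Matrix.mul_assoc, hgs, Matrix.mul_assoc]
  have t2 : k * (Y - S * X) = k * Y - S * (g * X) := by
    rw [Matrix.mul_sub, ← Matrix.mul_assoc, hsg, Matrix.mul_assoc]
  have hg' : X.transpose * (g * X) + X.transpose * (S.transpose * (S * (g * X))) =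
      X.transpose * X := by
    have : g + S.transpose * (S * g) = 1 := by
      rw [← hsg, ← Matrix.mul_assoc, ← hgs, Matrix.mul_assoc]; exact hg
    rw [← Matrix.mul_add]
    congr 1
    conv_rhs => rw [← Matrix.one_mul X, ← this]
    simp only [Matrix.add_mul, Matrix.mul_assoc]
  have hh' : Y.transpose * (k * Y) + Y.transpose * (S * (S.transpose * (k * Y))) =
      Y.transpose * Y := by
    have : k + S * (S.transpose * k) = 1 := by
      rw [← hgs, ← Matrix.mul_assoc, ← hsg, Matrix.mul_assoc]; exact hh
    rw [← Matrix.mul_add]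
    congr 1
    conv_rhs => rw [← Matrix.one_mul Y, ← this]
    simp only [Matrix.add_mul, Matrix.mul_assoc]
  rw [t1, t2, Matrix.transpose_add, Matrix.transpose_sub, Matrix.transpose_mul,
    Matrix.transpose_mul, Matrix.transpose_transpose, ← h, ← hg', ← hh']
  simp only [Matrix.add_mul, Matrix.mul_add, Matrix.sub_mul, Matrix.mul_sub, Matrix.mul_assoc]
  abel

/-! ### The coefficients of `Θ` -/

/-- In M - N the Y-terms cancel and leave G^{-1/2}GX, while N = G^{-1/2}G·G⁻¹Sᵀ(Y - SX) by the
intertwining of G^{-1/2} and H^{-1/2}. The common left factor has determinant √g. -/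
theorem thetaCovector_eq_mixRows (S : Matrix (Fin m) (Fin n) ℝ) (v : Fin n → Amb n m) :
    thetaCovector S v = Real.sqrt (matG S).det * ((coordX v).det + ∑ i,
      (mixRows {i} ((matG S)⁻¹ * S.transpose * (coordY v - S * coordX v)) (coordX v)).det) := by
  rw [thetaCovector_eq_thetaDet, inner_tangentFrame, inner_tangentToNormal,
    ← det_invSqrt_mul (matG_posDef S)]
  set X := coordX v
  set Y := coordY v
  have h := invSqrt_mul (matG_posDef S)
  refine thetaDet_eq_of_factor ?_ ?_
  · rw [← Matrix.mul_assoc S.transpose, ← invSqrt_matG_mul_transpose, Matrix.mul_assoc,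
      ← Matrix.mul_sub, Matrix.mul_assoc]
    congr 1
    rw [matG]
    simp only [Matrix.add_mul, Matrix.mul_sub, Matrix.one_mul, Matrix.mul_assoc]
    abel
  · rw [← Matrix.mul_assoc S.transpose, ← invSqrt_matG_mul_transpose,
      ← invSqrt_mul_self (matG_posDef S), ← Matrix.mul_assoc, ← Matrix.mul_assoc,
      ← Matrix.mul_assoc, h, Matrix.one_mul]

theorem det_mixRows_singleton_mul {ι κ : Type*} [Fintype ι] [DecidableEq ι] [Fintype κ]
    (A : Matrix ι κ ℝ) (Y : Matrix κ ι ℝ) (X : Matrix ι ι ℝ) (i : ι) :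
    (mixRows {i} (A * Y) X).det = ∑ a, A i a * (X.updateRow i (Y a)).det := by
  have h1 : mixRows {i} (A * Y) X = X.updateRow i (∑ a, A i a • Y a) := by
    ext j k
    by_cases hj : j = i
    · subst hj; simp [mixRows, Matrix.mul_apply]
    · simp [mixRows, hj]
  rw [h1]
  refine ((Matrix.detRowAlternating (R := ℝ) (n := ι)).toMultilinearMap.map_update_sum _ i _ X).trans
    ?_
  exact Finset.sum_congr rfl fun a _ => Matrix.det_updateRow_smul X i (A i a) (Y a)

theorem sum_det_mixRows_singleton_mul {ι : Type*} [Fintype ι] [DecidableEq ι]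
    (A X : Matrix ι ι ℝ) :
    ∑ i, (mixRows {i} (A * X) X).det = A.trace * X.det := by
  simp_rw [det_mixRows_singleton_mul, Matrix.trace, Finset.sum_mul]
  refine Finset.sum_congr rfl fun i _ => ?_
  rw [Finset.sum_eq_single i]
  · rw [Matrix.updateRow_eq_self, Matrix.diag_apply]
  · intro j _ hj
    rw [Matrix.det_updateRow_eq_zero hj, mul_zero]
  · simp

theorem det_mixRows_singleton_sub {ι : Type*} [Fintype ι] [DecidableEq ι]
    (A B X : Matrix ι ι ℝ) (i : ι) :
    (mixRows {i} (A - B) X).det = (mixRows {i} A X).det - (mixRows {i} B X).det := by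
  have h : ∀ C : Matrix ι ι ℝ, mixRows {i} C X = X.updateRow i (C i) := by
    intro C
    ext j k
    by_cases hj : j = i
    · subst hj; simp [mixRows]
    · simp [mixRows, hj]
  rw [h, h, h]
  exact (Matrix.detRowAlternating (R := ℝ) (n := ι)).map_update_sub X i (A i) (B i)

/-- The coefficients `√g g^{ij} ∂_j f_α`. -/
def fluxCoeff (S : Matrix (Fin m) (Fin n) ℝ) : Matrix (Fin n) (Fin m) ℝ :=
  Real.sqrt (matG S).det • ((matG S)⁻¹ * S.transpose)

/-- The coefficient of `dx` in `Θ`. -/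
def baseCoeff (S : Matrix (Fin m) (Fin n) ℝ) : ℝ :=
  Real.sqrt (matG S).det - (fluxCoeff S * S).trace

theorem thetaCovector_eq_coeff (S : Matrix (Fin m) (Fin n) ℝ) (v : Fin n → Amb n m) :
    thetaCovector S v = baseCoeff S * (coordX v).det +
      ∑ i, ∑ a, fluxCoeff S i a * ((coordX v).updateRow i (coordY v a)).det := by
  rw [thetaCovector_eq_mixRows, Matrix.mul_sub, ← Matrix.mul_assoc]
  simp_rw [det_mixRows_singleton_sub]
  rw [Finset.sum_sub_distrib, sum_det_mixRows_singleton_mul]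
  simp_rw [det_mixRows_singleton_mul]
  simp only [baseCoeff, fluxCoeff, Matrix.smul_mul, Matrix.trace_smul, Matrix.smul_apply,
    smul_eq_mul, mul_assoc, ← Finset.mul_sum]
  ring

/-! ### The comass of `Θ` -/

/-- A partial singular value decomposition `S U = W Λ`: the columns of `U` form an orthonormal
basis, and those of `W` are orthonormal or zero. -/
theorem exists_singular_decomposition (T : E n →ₗ[ℝ] E m) (S : Matrix (Fin m) (Fin n) ℝ)
    (hS : ∀ v : E n, T v = WithLp.toLp 2 (S.mulVec v.ofLp)) :
    ∃ (U : Matrix (Fin n) (Fin n) ℝ) (W : Matrix (Fin m) (Fin n) ℝ), U.transpose * U = 1 ∧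
      S * U = W * Matrix.diagonal (fun i : Fin n => T.singularValues i) ∧
      (1 - W * W.transpose).PosSemidef := by
  have hn : Module.finrank ℝ (E n) = n := by simp
  obtain ⟨l, hl⟩ : ∃ l : Fin n → ℝ, l = fun i : Fin n => T.singularValues i := ⟨_, rfl⟩
  obtain ⟨b, hb⟩ : ∃ b : OrthonormalBasis (Fin n) ℝ (E n),
      ∀ i j, inner ℝ (T (b i)) (T (b j)) = if i = j then l i ^ 2 else 0 := by
    refine ⟨T.isSymmetric_adjoint_comp_self.eigenvectorBasis hn, fun i j => ?_⟩
    rw [← LinearMap.adjoint_inner_right, ← LinearMap.comp_apply,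
      T.isSymmetric_adjoint_comp_self.apply_eigenvectorBasis hn j, inner_smul_right,
      orthonormal_iff_ite.1 (OrthonormalBasis.orthonormal _) i j, ← T.sq_singularValues_fin hn, hl]
    by_cases hij : i = j
    · subst hij; simp
    · simp [hij]
  rw [← hl]
  set U : Matrix (Fin n) (Fin n) ℝ := Matrix.of fun k i => (b i) k
  have hU : U.transpose * U = 1 := by
    ext i j
    have := orthonormal_iff_ite.1 b.orthonormal i j
    rw [EuclideanSpace.inner_eq_star_dotProduct, star_trivial] at this
    rw [Matrix.one_apply, ← this, Matrix.mul_apply]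
    simp [U, dotProduct, mul_comm]
  have hSU : ∀ a i, (S * U) a i = (T (b i)) a := by
    intro a i
    rw [hS]
    rfl
  have hgram : (S * U).transpose * (S * U) = Matrix.diagonal fun i => l i ^ 2 := by
    ext i j
    rw [Matrix.diagonal_apply, ← hb, EuclideanSpace.inner_eq_star_dotProduct, star_trivial,
      Matrix.mul_apply]
    simp only [Matrix.transpose_apply, hSU, dotProduct]
    exact Finset.sum_congr rfl fun a _ => mul_comm _ _
  -- The convention 0⁻¹ = 0 makes the columns for vanishing singular values zero, so WWᵀ is an
  -- orthogonal projection.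
  refine ⟨U, S * U * Matrix.diagonal fun i => (l i)⁻¹, hU, ?_, ?_⟩
  · ext a i
    rw [Matrix.mul_diagonal, Matrix.mul_diagonal]
    by_cases hi : l i = 0
    · have h0 : inner ℝ (T (b i)) (T (b i)) = 0 := by rw [hb]; simp [hi]
      rw [hSU, inner_self_eq_zero.1 h0]
      simp
    · rw [mul_assoc, inv_mul_cancel₀ hi, mul_one]
  · set W := S * U * Matrix.diagonal fun i => (l i)⁻¹
    have hWW : W.transpose * W = Matrix.diagonal fun i => (l i)⁻¹ * l i ^ 2 * (l i)⁻¹ := by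
      simp only [W]
      rw [Matrix.transpose_mul, Matrix.diagonal_transpose, Matrix.mul_assoc,
        ← Matrix.mul_assoc (S * U).transpose, hgram, Matrix.diagonal_mul_diagonal,
        Matrix.diagonal_mul_diagonal]
      simp only [mul_assoc]
    have hW : W * (W.transpose * W) = W := by
      rw [hWW]
      ext a i
      rw [Matrix.mul_diagonal]
      by_cases hi : l i = 0
      · simp [W, Matrix.mul_diagonal, hi]
      · field_simp
    have : 1 - W * W.transpose = (1 - W * W.transpose).conjTranspose * (1 - W * W.transpose) := by
      have h2 : W * W.transpose * (W * W.transpose) = W * W.transpose := by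
        rw [← Matrix.mul_assoc, Matrix.mul_assoc W, hW]
      simp only [Matrix.conjTranspose_eq_transpose_of_trivial, Matrix.transpose_sub,
        Matrix.transpose_one, Matrix.transpose_mul, Matrix.transpose_transpose, mul_sub, sub_mul,
        mul_one, one_mul, h2]
      abel
    rw [this]
    exact Matrix.posSemidef_conjTranspose_mul_self _

theorem thetaCovector_le_one (T : E n →ₗ[ℝ] E m) (S : Matrix (Fin m) (Fin n) ℝ)
    (hS : ∀ v : E n, T v = WithLp.toLp 2 (S.mulVec v.ofLp)) {r : ℕ} {q : ℝ} (hq : 0 ≤ q)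
    (hqr : q * r ≤ 1 / 50) (hr : ∀ i, r ≤ i → T.singularValues i = 0)
    (hT : ∀ j k : ℕ, j < k → k < r → T.singularValues j * T.singularValues k ≤ q)
    {v : Fin n → Amb n m} (hv : Orthonormal ℝ v) : thetaCovector S v ≤ 1 := by
  obtain ⟨U, W, hU, hSU, hW⟩ := exists_singular_decomposition T S hS
  set l : Fin n → ℝ := fun i => T.singularValues i
  rw [thetaCovector_eq_thetaDet, inner_tangentFrame, inner_tangentToNormal]
  have hgram := gram_eq_one S (transpose_coord_of_orthonormal hv)
  set M := invSqrt (matG S) * (coordX v + S.transpose * coordY v)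
  set Z := invSqrt (matH S) * (coordY v - S * coordX v)
  have hdetU : U.det * U.det = 1 := by
    have := congrArg Matrix.det hU
    rwa [Matrix.det_mul, Matrix.det_transpose, Matrix.det_one] at this
  have hUN : U.transpose * (S.transpose * Z) = Matrix.diagonal l * (W.transpose * Z) := by
    have := congrArg Matrix.transpose hSU
    rw [Matrix.transpose_mul, Matrix.transpose_mul, Matrix.diagonal_transpose] at this
    rw [← Matrix.mul_assoc, this, Matrix.mul_assoc]
  have hth : thetaDet M (S.transpose * Z) =
      U.det * thetaDet (U.transpose * M) (Matrix.diagonal l * (W.transpose * Z)) := by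
    refine thetaDet_congr fun t => ?_
    rw [← hUN, ← Matrix.mul_smul U.transpose, ← Matrix.mul_sub U.transpose, Matrix.det_mul,
      Matrix.det_transpose, ← mul_assoc, hdetU, one_mul]
  -- Uᵀ is orthogonal and 1 - WWᵀ is positive semidefinite, so the new Gram matrix is dominated by
  -- the old one, which is the identity.
  have hdet : ((U.transpose * M).transpose * (U.transpose * M) +
      (W.transpose * Z).transpose * (W.transpose * Z)).det ≤ 1 := by
    have hUU := mul_eq_one_comm.1 hU
    have h1 := hW.conjTranspose_mul_mul_same Z
    have h2 := Matrix.posSemidef_conjTranspose_mul_self (U.transpose * M)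
    have h3 := Matrix.posSemidef_conjTranspose_mul_self (W.transpose * Z)
    have h4 := det_le_det_add (h2.add h3) h1
    simp only [Matrix.conjTranspose_eq_transpose_of_trivial] at h4
    refine h4.trans (le_of_eq ?_)
    rw [← Matrix.det_one (n := Fin n), ← hgram]
    congr 1
    simp only [Matrix.transpose_mul, Matrix.transpose_transpose, Matrix.mul_assoc, Matrix.mul_sub,
      Matrix.sub_mul, Matrix.one_mul]
    rw [← Matrix.mul_assoc U, hUU, Matrix.one_mul]
    abel
  have hl0 : ∀ i, 0 ≤ l i := fun i => T.singularValues_nonneg i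
  have hlq : ∀ i j, i ≠ j → l i * l j ≤ q := by
    have hlt : ∀ i j : Fin n, i < j → l i * l j ≤ q := by
      intro i j hij
      by_cases hj : (j : ℕ) < r
      · exact hT i j hij hj
      · simp only [l, hr j (not_lt.1 hj), mul_zero, hq]
    intro i j hij
    rcases lt_or_gt_of_ne hij with h | h
    · exact hlt i j h
    · rw [mul_comm]; exact hlt j i h
  have hcard : q * ((Finset.univ.filter fun i : Fin n => (i : ℕ) < r).card : ℝ) ≤ 1 / 50 := by
    refine le_trans (mul_le_mul_of_nonneg_left ?_ hq) hqr
    have : (Finset.univ.filter fun i : Fin n => (i : ℕ) < r).card ≤ (Finset.range r).card :=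
      Finset.card_le_card_of_injOn (fun i => (i : ℕ)) (fun i hi => by simpa using hi)
        (Fin.val_injective.injOn)
    rw [Finset.card_range] at this
    exact_mod_cast this
  have hw := sum_weights_le l q hl0 hlq (Finset.univ.filter fun i : Fin n => (i : ℕ) < r)
    (fun i hi => hr i (by simpa using hi)) hq hcard
  have hmain := abs_det_add_sum_minors_le_one (U.transpose * M) (W.transpose * Z) hdet _ hw
  -- The weight 1 - |I| is zero on singletons.
  have hsum : thetaDet (U.transpose * M) (Matrix.diagonal l * (W.transpose * Z)) =
      (U.transpose * M).det + ∑ I : Finset (Fin n) with 2 ≤ I.card,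
        (-1) ^ I.card * (1 - (I.card : ℝ)) * (∏ i ∈ I, l i) *
          (mixRows I (W.transpose * Z) (U.transpose * M)).det := by
    rw [sum_two_le_card, thetaDet]
    simp_rw [det_mixRows_diagonal_mul]
    simp [mixRows_empty, mul_assoc]
  have hU1 : |U.det| = 1 := by
    have : |U.det| ^ 2 = 1 := by rw [sq_abs, sq, hdetU]
    exact (pow_eq_one_iff_of_nonneg (abs_nonneg _) two_ne_zero).1 this
  rw [hth, hsum]
  refine (le_abs_self _).trans ?_
  rw [abs_mul, hU1, one_mul]
  exact hmain

/-! ### Smooth families of matrices -/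

section MatrixCalculus

variable {V : Type*} [NormedAddCommGroup V] [NormedSpace ℝ V] {ι κ μ : Type*}
  {x : V}

theorem contDiffAt_det [Fintype ι] [DecidableEq ι] {A : V → Matrix ι ι ℝ}
    (hA : ∀ i j, ContDiffAt ℝ ∞ (fun y => A y i j) x) :
    ContDiffAt ℝ ∞ (fun y => (A y).det) x := by
  simp_rw [Matrix.det_apply']
  exact ContDiffAt.sum fun σ _ => contDiffAt_const.mul (contDiffAt_prod fun i _ => hA _ _)

theorem contDiffAt_inv_apply [Fintype ι] [DecidableEq ι] {A : V → Matrix ι ι ℝ}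
    (hA : ∀ i j, ContDiffAt ℝ ∞ (fun y => A y i j) x) (h0 : (A x).det ≠ 0) (i j : ι) :
    ContDiffAt ℝ ∞ (fun y => (A y)⁻¹ i j) x := by
  simp only [Matrix.inv_def, Matrix.smul_apply, smul_eq_mul, Ring.inverse_eq_inv',
    Matrix.adjugate_apply]
  refine ((contDiffAt_det hA).inv h0).mul (contDiffAt_det fun k l => ?_)
  by_cases hk : k = j
  · subst hk
    simp only [Matrix.updateRow_self]
    exact contDiffAt_const
  · simp only [Matrix.updateRow_ne hk]
    exact hA k l

theorem contDiffAt_mul_apply [Fintype κ] {A : V → Matrix μ κ ℝ} {B : V → Matrix κ ι ℝ}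
    (hA : ∀ i j, ContDiffAt ℝ ∞ (fun y => A y i j) x)
    (hB : ∀ i j, ContDiffAt ℝ ∞ (fun y => B y i j) x) (i : μ) (j : ι) :
    ContDiffAt ℝ ∞ (fun y => (A y * B y) i j) x := by
  simp_rw [Matrix.mul_apply]
  exact ContDiffAt.sum fun k _ => (hA i k).mul (hB k j)

/-- `A'` is the entrywise derivative at `t` of a one-parameter family `A` of matrices. -/
def HasEntrywiseDerivAt (A : ℝ → Matrix κ μ ℝ) (A' : Matrix κ μ ℝ) (t : ℝ) : Prop :=
  ∀ i j, HasDerivAt (fun s => A s i j) (A' i j) t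

theorem HasEntrywiseDerivAt.mul [Fintype κ] {A : ℝ → Matrix μ κ ℝ} {B : ℝ → Matrix κ ι ℝ} {A' B'} {t : ℝ}
    (hA : HasEntrywiseDerivAt A A' t) (hB : HasEntrywiseDerivAt B B' t) :
    HasEntrywiseDerivAt (fun s => A s * B s) (A' * B t + A t * B') t := by
  intro i j
  simp only [Matrix.mul_apply, Matrix.add_apply, ← Finset.sum_add_distrib]
  exact HasDerivAt.fun_sum fun k _ => (hA i k).mul (hB k j)

theorem HasEntrywiseDerivAt.transpose {A : ℝ → Matrix μ κ ℝ} {A'} {t : ℝ}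
    (hA : HasEntrywiseDerivAt A A' t) :
    HasEntrywiseDerivAt (fun s => (A s).transpose) A'.transpose t :=
  fun i j => hA j i

/-- Jacobi's formula, by comparing the product rule in the Leibniz expansion with Cramer's rule
column by column. -/
theorem HasEntrywiseDerivAt.det [Fintype ι] [DecidableEq ι] {A : ℝ → Matrix ι ι ℝ} {A'} {t : ℝ}
    (hA : HasEntrywiseDerivAt A A' t) :
    HasDerivAt (fun s => (A s).det) ((A t).adjugate * A').trace t := by
  have h1 : ((A t).adjugate * A').trace = ∑ σ : Equiv.Perm ι, ((Equiv.Perm.sign σ : ℤ) : ℝ) *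
      ∑ i, (∏ j ∈ Finset.univ.erase i, A t (σ j) j) * A' (σ i) i := by
    have h2 : ∀ i, ((A t).adjugate * A') i i = ((A t).updateCol i (A'.col i)).det := by
      intro i
      rw [← Matrix.cramer_apply, Matrix.cramer_eq_adjugate_mulVec]
      rfl
    simp_rw [Matrix.trace, Matrix.diag_apply, h2, Matrix.det_apply', Finset.mul_sum]
    rw [Finset.sum_comm]
    refine Finset.sum_congr rfl fun σ _ => Finset.sum_congr rfl fun i _ => ?_
    rw [← Finset.mul_prod_erase _ _ (Finset.mem_univ i), mul_comm (∏ j ∈ _, _)]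
    congr 2
    · simp
    · refine Finset.prod_congr rfl fun j hj => ?_
      rw [Matrix.updateCol_ne (Finset.ne_of_mem_erase hj)]
  rw [h1]
  simp_rw [Matrix.det_apply']
  refine HasDerivAt.fun_sum fun σ _ => HasDerivAt.const_mul _ ?_
  simpa using HasDerivAt.fun_finsetProd (u := Finset.univ) fun i _ => hA (σ i) i

theorem HasEntrywiseDerivAt.inv [Fintype ι] [DecidableEq ι] {A : ℝ → Matrix ι ι ℝ} {A' K'} {t : ℝ}
    (hA : HasEntrywiseDerivAt A A' t) (hK : HasEntrywiseDerivAt (fun s => (A s)⁻¹) K' t)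
    (h0 : ∀ s, IsUnit (A s).det) : K' = -((A t)⁻¹ * A' * (A t)⁻¹) := by
  have h1 : K' * A t + (A t)⁻¹ * A' = 0 := by
    ext i j
    have h2 := hK.mul hA i j
    simp_rw [Matrix.nonsing_inv_mul _ (h0 _)] at h2
    exact h2.unique (hasDerivAt_const _ _)
  rw [← Matrix.neg_mul, ← eq_neg_of_add_eq_zero_left h1, Matrix.mul_assoc,
    Matrix.mul_nonsing_inv _ (h0 t), Matrix.mul_one]

end MatrixCalculus

theorem contDiffAt_matG_apply {V : Type*} [NormedAddCommGroup V] [NormedSpace ℝ V] {x : V}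
    {S : V → Matrix (Fin m) (Fin n) ℝ} (hS : ∀ i j, ContDiffAt ℝ ∞ (fun y => S y i j) x)
    (i j : Fin n) : ContDiffAt ℝ ∞ (fun y => matG (S y) i j) x :=
  contDiffAt_const.add (contDiffAt_mul_apply (A := fun y => (S y).transpose)
    (fun i j => hS j i) hS i j)

theorem contDiffAt_sqrt_det_matG {V : Type*} [NormedAddCommGroup V] [NormedSpace ℝ V] {x : V}
    {S : V → Matrix (Fin m) (Fin n) ℝ} (hS : ∀ i j, ContDiffAt ℝ ∞ (fun y => S y i j) x) :
    ContDiffAt ℝ ∞ (fun y => Real.sqrt (matG (S y)).det) x :=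
  (contDiffAt_det (contDiffAt_matG_apply hS)).sqrt (matG_posDef (S x)).det_pos.ne'

theorem contDiffAt_fluxCoeff {V : Type*} [NormedAddCommGroup V] [NormedSpace ℝ V] {x : V}
    {S : V → Matrix (Fin m) (Fin n) ℝ} (hS : ∀ i j, ContDiffAt ℝ ∞ (fun y => S y i j) x)
    (i : Fin n) (a : Fin m) : ContDiffAt ℝ ∞ (fun y => fluxCoeff (S y) i a) x := by
  simp only [fluxCoeff, Matrix.smul_apply, smul_eq_mul]
  exact (contDiffAt_sqrt_det_matG hS).mul (contDiffAt_mul_apply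
    (contDiffAt_inv_apply (contDiffAt_matG_apply hS) (matG_posDef (S x)).det_pos.ne')
    (fun i j => hS j i) i a)

theorem contDiffAt_baseCoeff {V : Type*} [NormedAddCommGroup V] [NormedSpace ℝ V] {x : V}
    {S : V → Matrix (Fin m) (Fin n) ℝ} (hS : ∀ i j, ContDiffAt ℝ ∞ (fun y => S y i j) x) :
    ContDiffAt ℝ ∞ (fun y => baseCoeff (S y)) x := by
  simp only [baseCoeff, Matrix.trace, Matrix.diag_apply]
  exact (contDiffAt_sqrt_det_matG hS).sub
    (ContDiffAt.sum fun i _ => contDiffAt_mul_apply (contDiffAt_fluxCoeff hS) hS i i)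

/-- The derivative of `√g g^{ij} ∂_j f_α` along a variation `D` of the first derivatives. -/
def fluxDeriv (S D : Matrix (Fin m) (Fin n) ℝ) : Matrix (Fin n) (Fin m) ℝ :=
  Real.sqrt (matG S).det • (((matG S)⁻¹ * S.transpose * D).trace • ((matG S)⁻¹ * S.transpose) -
    (matG S)⁻¹ * (D.transpose * S + S.transpose * D) * ((matG S)⁻¹ * S.transpose) +
    (matG S)⁻¹ * D.transpose)

theorem hasEntrywiseDerivAt_fluxCoeff {S : ℝ → Matrix (Fin m) (Fin n) ℝ}
    {D : Matrix (Fin m) (Fin n) ℝ} {t : ℝ} (hc : ∀ i j, ContDiffAt ℝ ∞ (fun s => S s i j) t)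
    (hS : HasEntrywiseDerivAt S D t) :
    HasEntrywiseDerivAt (fun s => fluxCoeff (S s)) (fluxDeriv (S t) D) t := by
  have hG : HasEntrywiseDerivAt (fun s => matG (S s))
      (D.transpose * S t + (S t).transpose * D) t := by
    intro i j
    exact (hS.transpose.mul hS i j).const_add _
  have hunit : ∀ s, IsUnit (matG (S s)).det := fun s => (matG_posDef (S s)).det_pos.ne'.isUnit
  obtain ⟨K', hK⟩ : ∃ K', HasEntrywiseDerivAt (fun s => (matG (S s))⁻¹) K' t :=
    ⟨Matrix.of fun i j => deriv (fun s => (matG (S s))⁻¹ i j) t, fun i j =>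
      ((contDiffAt_inv_apply (contDiffAt_matG_apply hc) (hunit t).ne_zero i j).differentiableAt
        (by simp)).hasDerivAt⟩
  have hK' := hG.inv hK hunit
  have hpos := (matG_posDef (S t)).det_pos
  have hs := hG.det.sqrt hpos.ne'
  have hadj : (matG (S t)).adjugate = (matG (S t)).det • (matG (S t))⁻¹ := by
    rw [Matrix.inv_def, Ring.inverse_eq_inv', smul_smul, mul_inv_cancel₀ hpos.ne', one_smul]
  have htr : ((matG (S t))⁻¹ * (D.transpose * S t + (S t).transpose * D)).trace =
      2 * ((matG (S t))⁻¹ * (S t).transpose * D).trace := by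
    rw [Matrix.mul_add, Matrix.trace_add, ← Matrix.trace_transpose (_ * (D.transpose * S t)),
      Matrix.transpose_mul, Matrix.transpose_mul, Matrix.transpose_transpose,
      Matrix.transpose_nonsing_inv,
      show (matG (S t)).transpose = matG (S t) from (matG_posDef (S t)).isHermitian,
      Matrix.trace_mul_comm, ← Matrix.mul_assoc]
    ring
  have hs2 : (matG (S t)).det / Real.sqrt (matG (S t)).det = Real.sqrt (matG (S t)).det :=
    Real.div_sqrt
  rw [hadj, Matrix.smul_mul, Matrix.trace_smul, htr, smul_eq_mul] at hs
  intro i a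
  have h := hs.mul (hK.mul hS.transpose i a)
  refine (h.congr_deriv ?_).congr_of_eventuallyEq (Filter.Eventually.of_forall fun s => ?_)
  · rw [hK']
    simp only [fluxDeriv, Matrix.smul_apply, Matrix.add_apply, Matrix.sub_apply, smul_eq_mul,
      Matrix.neg_mul, Matrix.neg_apply]
    rw [← Matrix.mul_assoc (_ * _) (matG (S t))⁻¹ (S t).transpose]
    have hs3 : (matG (S t)).det * (2 * ((matG (S t))⁻¹ * (S t).transpose * D).trace) /
        (2 * Real.sqrt (matG (S t)).det) =
        Real.sqrt (matG (S t)).det * ((matG (S t))⁻¹ * (S t).transpose * D).trace := by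
      conv_rhs => rw [← hs2]
      ring
    rw [hs3]
    ring
  · simp [fluxCoeff]

/-- The flux is divergence free when `g^{ij} ∂_i ∂_j f_α = 0`. -/
theorem sum_fluxDeriv_eq_zero (S : Matrix (Fin m) (Fin n) ℝ)
    (D : Fin n → Matrix (Fin m) (Fin n) ℝ) (hsymm : ∀ a i j, D i a j = D j a i)
    (hmin : ∀ a, ∑ i, ∑ j, (matG S)⁻¹ i j * D i a j = 0) (a : Fin m) :
    ∑ i, fluxDeriv S (D i) i a = 0 := by
  set K := (matG S)⁻¹
  have h3 : ∀ c, ∑ i, (K * (D i).transpose) i c = 0 := by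
    intro c
    rw [← hmin c]
    refine Finset.sum_congr rfl fun i _ => ?_
    rw [Matrix.mul_apply]
    rfl
  have h2 : ∀ W : Matrix (Fin m) (Fin m) ℝ, ∑ i, (K * (D i).transpose * W) i a = 0 := by
    intro W
    simp_rw [Matrix.mul_apply (N := W)]
    rw [Finset.sum_comm]
    refine Finset.sum_eq_zero fun c _ => ?_
    rw [← Finset.sum_mul, h3, zero_mul]
  set B := K * S.transpose
  -- Symmetry of second derivatives lets the derivative of √g cancel one half of the derivative of
  -- g⁻¹; every other term contains ∑ᵢ (K Dᵢᵀ)ᵢc, which is zero by minimality.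
  have h1 : ∑ i, (B * D i).trace * B i a = ∑ i, (B * D i * B) i a := by
    have e1 : ∀ i, (B * D i).trace * B i a = ∑ p, (B * D i) p p * B i a := by
      intro i
      rw [Matrix.trace, Finset.sum_mul]
      rfl
    simp_rw [e1, Matrix.mul_apply (N := B)]
    rw [Finset.sum_comm]
    refine Finset.sum_congr rfl fun p _ => Finset.sum_congr rfl fun i _ => ?_
    congr 1
    rw [Matrix.mul_apply, Matrix.mul_apply]
    exact Finset.sum_congr rfl fun c _ => by rw [hsymm]
  have e : ∀ i, fluxDeriv S (D i) i a = Real.sqrt (matG S).det * ((B * D i).trace * B i a -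
      (K * (D i).transpose * (S * B)) i a - (B * D i * B) i a + (K * (D i).transpose) i a) := by
    intro i
    have : K * ((D i).transpose * S + S.transpose * D i) * B =
        K * (D i).transpose * (S * B) + B * D i * B := by
      simp only [B, Matrix.mul_add, Matrix.add_mul, Matrix.mul_assoc]
    rw [fluxDeriv]
    change (Real.sqrt (matG S).det • ((B * D i).trace • B -
      K * ((D i).transpose * S + S.transpose * D i) * B + K * (D i).transpose)) i a = _
    rw [this]
    simp only [Matrix.smul_apply, Matrix.add_apply, Matrix.sub_apply, smul_eq_mul]
    ring
  simp_rw [e]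
  rw [← Finset.mul_sum, Finset.sum_add_distrib, Finset.sum_sub_distrib, Finset.sum_sub_distrib,
    h1, h2, h3]
  ring

/-! ### Decomposable covectors -/

section RowForm

variable {V : Type*} [NormedAddCommGroup V] [NormedSpace ℝ V] {k : ℕ}

/-- The decomposable covector `φ₁ ∧ ⋯ ∧ φ_k`. -/
def rowForm (φ : Fin k → V →L[ℝ] ℝ) : V [⋀^Fin k]→L[ℝ] ℝ :=
  { (Matrix.detRowAlternating (R := ℝ) (n := Fin k)).compLinearMap
      (LinearMap.pi fun i => (φ i : V →ₗ[ℝ] ℝ)) with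
    cont := by
      change Continuous fun v : Fin k → V => Matrix.det (fun j i => φ i (v j))
      exact Continuous.matrix_det (by fun_prop) }

theorem rowForm_apply (φ : Fin k → V →L[ℝ] ℝ) (v : Fin k → V) :
    rowForm φ v = (Matrix.of fun i j => φ i (v j)).det := by
  rw [← Matrix.det_transpose]
  rfl

theorem rowForm_cons (α : V →L[ℝ] ℝ) (φ : Fin k → V →L[ℝ] ℝ) (v : Fin (k + 1) → V) :
    rowForm (Fin.cons α φ : Fin (k + 1) → V →L[ℝ] ℝ) v =
      ∑ j : Fin (k + 1), (-1) ^ (j : ℕ) * (α (v j) * rowForm φ (j.removeNth v)) := by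
  rw [rowForm_apply, Matrix.det_succ_row_zero]
  refine Finset.sum_congr rfl fun j _ => ?_
  rw [rowForm_apply, mul_assoc]
  rfl

theorem rowForm_eq_zero {φ : Fin k → V →L[ℝ] ℝ} {i j : Fin k} (hij : i ≠ j) (h : φ i = φ j)
    (v : Fin k → V) : rowForm φ v = 0 := by
  rw [rowForm_apply]
  refine Matrix.det_zero_of_row_eq hij ?_
  ext l
  simp [h]

theorem rowForm_cons_update_self (α : V →L[ℝ] ℝ) (φ : Fin k → V →L[ℝ] ℝ) (i : Fin k)
    (v : Fin (k + 1) → V) :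
    rowForm (Fin.cons (φ i) (Function.update φ i α) : Fin (k + 1) → V →L[ℝ] ℝ) v =
      -rowForm (Fin.cons α φ : Fin (k + 1) → V →L[ℝ] ℝ) v := by
  have h0 : (0 : Fin (k + 1)) ≠ i.succ := (Fin.succ_ne_zero i).symm
  rw [rowForm_apply, rowForm_apply]
  have := (Matrix.detRowAlternating (R := ℝ) (n := Fin (k + 1))).map_swap
    (Matrix.of fun i j => (Fin.cons α φ : Fin (k + 1) → V →L[ℝ] ℝ) i (v j)) h0
  refine Eq.trans ?_ this
  change Matrix.det _ = Matrix.det _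
  congr 1
  ext l j
  simp only [Matrix.of_apply]
  congr 1
  refine Fin.cases ?_ (fun l => ?_) l
  · simp
  · by_cases hl : l = i
    · subst hl; simp
    · rw [Equiv.swap_apply_of_ne_of_ne (Fin.succ_ne_zero l) (fun h => hl (Fin.succ_injective _ h))]
      simp [hl]

end RowForm

/-! ### Derivatives of affine graphs and of coefficients pulled back by a projection -/

section Calculus

variable {V V' W : Type*} [NormedAddCommGroup V] [NormedSpace ℝ V] [NormedAddCommGroup V']
  [NormedSpace ℝ V'] [NormedAddCommGroup W] [NormedSpace ℝ W]

theorem fderiv_clm_add_clm_comp (A : V →L[ℝ] W) (B : V' →L[ℝ] W) {F : V → V'} {x : V}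
    (hF : DifferentiableAt ℝ F x) :
    fderiv ℝ (fun y => A y + B (F y)) x = A + B ∘L fderiv ℝ F x :=
  (A.hasFDerivAt.add (B.hasFDerivAt.comp x hF.hasFDerivAt)).fderiv

theorem fderiv_fderiv_clm_add_clm_comp (A : V →L[ℝ] W) (B : V' →L[ℝ] W) {F : V → V'} {x : V}
    (hF : ContDiffAt ℝ ∞ F x) (u v : V) :
    fderiv ℝ (fderiv ℝ fun y => A y + B (F y)) x u v = B (fderiv ℝ (fderiv ℝ F) x u v) := by
  have h1 : (fderiv ℝ fun y => A y + B (F y)) =ᶠ[nhds x] fun y =>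
      A + ContinuousLinearMap.compL ℝ V V' W B (fderiv ℝ F y) := by
    filter_upwards [(hF.of_le (show (1 : WithTop ℕ∞) ≤ ∞ by simp)).eventually (by simp)] with y hy
    exact fderiv_clm_add_clm_comp A B (hy.differentiableAt (by simp))
  have h2 : DifferentiableAt ℝ (fderiv ℝ F) x :=
    (hF.fderiv_right (m := ∞) (by simp)).differentiableAt (by simp)
  have h3 := (((ContinuousLinearMap.compL ℝ V V' W B).hasFDerivAt.comp x
    h2.hasFDerivAt).const_add A).fderiv
  rw [h1.fderiv_eq]
  exact congrArg (fun L : V →L[ℝ] V →L[ℝ] W => L u v) h3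

theorem fderiv_sum_comp_mul_const {ι κ : Type*} [Fintype ι] [Fintype κ] (π : V →L[ℝ] V')
    {f : V' → ℝ} {g : ι → κ → V' → ℝ} {p : V} (hf : DifferentiableAt ℝ f (π p))
    (hg : ∀ i a, DifferentiableAt ℝ (g i a) (π p)) (c : ℝ) (d : ι → κ → ℝ) (w : V) :
    fderiv ℝ (fun q => f (π q) * c + ∑ i, ∑ a, g i a (π q) * d i a) p w =
      fderiv ℝ f (π p) (π w) * c + ∑ i, ∑ a, fderiv ℝ (g i a) (π p) (π w) * d i a := by
  have h1 : ∀ {h : V' → ℝ}, DifferentiableAt ℝ h (π p) → ∀ e : ℝ,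
      HasFDerivAt (fun q => h (π q) * e) (e • (fderiv ℝ h (π p) ∘L π)) p :=
    fun hh e => (hh.hasFDerivAt.comp p π.hasFDerivAt).mul_const e
  have h2 := (h1 hf c).add (HasFDerivAt.fun_sum (u := Finset.univ) fun i _ =>
    HasFDerivAt.fun_sum (u := Finset.univ) fun a _ => h1 (hg i a) (d i a))
  refine (congrArg (fun L : V →L[ℝ] ℝ => L w) h2.fderiv).trans ?_
  simp [mul_comm]

end Calculus

/-- The projection of `ℝⁿ × ℝᵐ` to `ℝⁿ`. -/
def fstCLM (n m : ℕ) : Amb n m →L[ℝ] E n :=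
  ContinuousLinearMap.fst ℝ (E n) (E m) ∘L
    ((WithLp.prodContinuousLinearEquiv 2 ℝ (E n) (E m)) : Amb n m →L[ℝ] E n × E m)

/-- The projection of `ℝⁿ × ℝᵐ` to `ℝᵐ`. -/
def sndCLM (n m : ℕ) : Amb n m →L[ℝ] E m :=
  ContinuousLinearMap.snd ℝ (E n) (E m) ∘L
    ((WithLp.prodContinuousLinearEquiv 2 ℝ (E n) (E m)) : Amb n m →L[ℝ] E n × E m)

/-- The covector `dx_i`. -/
def dx (i : Fin n) : Amb n m →L[ℝ] ℝ := (EuclideanSpace.proj i : E n →L[ℝ] ℝ) ∘L fstCLM n m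

/-- The covector `dy_a`. -/
def dy (a : Fin m) : Amb n m →L[ℝ] ℝ := (EuclideanSpace.proj a : E m →L[ℝ] ℝ) ∘L sndCLM n m

/-- Constant covectors with coefficients depending on x alone: smoothness and the exterior
derivative reduce to these coefficients. -/
theorem Theta_eq (F : E n → E m) (p : Amb n m) :
    Theta F p = baseCoeff (jacobian F p.fst) • rowForm dx +
      ∑ i, ∑ a, fluxCoeff (jacobian F p.fst) i a • rowForm (Function.update dx i (dy a)) := by
  ext v
  rw [Theta, thetaCovector_eq_coeff, ContinuousAlternatingMap.add_apply,
    ContinuousAlternatingMap.smul_apply, rowForm_apply, ContinuousAlternatingMap.sum_apply]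
  congr 1
  refine Finset.sum_congr rfl fun i _ => ?_
  rw [ContinuousAlternatingMap.sum_apply]
  refine Finset.sum_congr rfl fun a _ => ?_
  rw [ContinuousAlternatingMap.smul_apply, rowForm_apply, smul_eq_mul]
  congr 2
  ext k j
  by_cases hk : k = i
  · subst hk
    simp only [Matrix.updateRow_self, Matrix.of_apply, Function.update_self]
    rfl
  · simp only [Matrix.updateRow_ne hk, Matrix.of_apply, Function.update_of_ne hk]
    rfl

/-! ### Smoothness -/

theorem contDiffAt_jacobian {F : E n → E m} {x : E n} (hF : ContDiffAt ℝ ∞ F x) (a : Fin m)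
    (j : Fin n) : ContDiffAt ℝ ∞ (fun y => jacobian F y a j) x := by
  have h1 : ContDiffAt ℝ ∞ (fderiv ℝ F) x := hF.fderiv_right (by simp)
  have h2 := h1.clm_apply (contDiffAt_const (c := (EuclideanSpace.single j (1 : ℝ) : E n)))
  exact (EuclideanSpace.proj a : E m →L[ℝ] ℝ).contDiff.contDiffAt.comp x h2

theorem contDiffAt_Theta {F : E n → E m} {p : Amb n m} (hF : ContDiffAt ℝ ∞ F p.fst) :
    ContDiffAt ℝ ∞ (Theta F) p := by
  have hfst : ContDiffAt ℝ ∞ (fun q : Amb n m => q.fst) p := (fstCLM n m).contDiff.contDiffAt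
  have hJ := contDiffAt_jacobian hF
  rw [show Theta F = _ from funext (Theta_eq F)]
  refine ContDiffAt.add ?_ (ContDiffAt.sum fun i _ => ContDiffAt.sum fun a _ => ?_)
  · exact ((contDiffAt_baseCoeff hJ).comp p hfst).smul contDiffAt_const
  · exact ((contDiffAt_fluxCoeff hJ i a).comp p hfst).smul contDiffAt_const

/-! ### The minimal surface system -/

/-- The inclusion of `ℝⁿ` in `ℝⁿ × ℝᵐ`. -/
def inlCLM (n m : ℕ) : E n →L[ℝ] Amb n m :=
  ((WithLp.prodContinuousLinearEquiv 2 ℝ (E n) (E m)).symm : E n × E m →L[ℝ] Amb n m) ∘L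
    ContinuousLinearMap.inl ℝ (E n) (E m)

/-- The inclusion of `ℝᵐ` in `ℝⁿ × ℝᵐ`. -/
def inrCLM (n m : ℕ) : E m →L[ℝ] Amb n m :=
  ((WithLp.prodContinuousLinearEquiv 2 ℝ (E n) (E m)).symm : E n × E m →L[ℝ] Amb n m) ∘L
    ContinuousLinearMap.inr ℝ (E n) (E m)

theorem graphMap_eq (F : E n → E m) :
    graphMap F = fun y => inlCLM n m y + inrCLM n m (F y) := by
  funext y
  simp [graphMap, inlCLM, inrCLM, ← WithLp.toLp_add]

theorem fderiv_graphMap {F : E n → E m} {x : E n} (hF : DifferentiableAt ℝ F x) :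
    fderiv ℝ (graphMap F) x = inlCLM n m + inrCLM n m ∘L fderiv ℝ F x := by
  rw [graphMap_eq]
  exact fderiv_clm_add_clm_comp _ _ hF

theorem fderiv_fderiv_graphMap {F : E n → E m} {x : E n} (hF : ContDiffAt ℝ ∞ F x) (u v : E n) :
    fderiv ℝ (fderiv ℝ (graphMap F)) x u v = inrCLM n m (fderiv ℝ (fderiv ℝ F) x u v) := by
  rw [graphMap_eq]
  exact fderiv_fderiv_clm_add_clm_comp _ _ hF u v

/-- The second derivatives of x ↦ (x, F x) have the form (0, ·), so vanishing mean curvature says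
that (0, w) is tangent. Tangent vectors are (u, dF u), and u = 0 forces w = 0. -/
theorem sum_inv_matG_mul_eq_zero {F : E n → E m} {x : E n} (hF : ContDiffAt ℝ ∞ F x)
    (hH : meanCurvature F x = 0) (a : Fin m) :
    ∑ i, ∑ j, (matG (jacobian F x))⁻¹ i j * (fderiv ℝ (fderiv ℝ F) x (EuclideanSpace.single i 1)
      (EuclideanSpace.single j 1)) a = 0 := by
  set w : E m := ∑ i, ∑ j, (matG (jacobian F x))⁻¹ i j •
    fderiv ℝ (fderiv ℝ F) x (EuclideanSpace.single i 1) (EuclideanSpace.single j 1)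
  have h1 : (tangentSpace F x)ᗮ.starProjection (inrCLM n m w) = 0 := by
    rw [← hH, meanCurvature]
    simp only [secondFundamentalForm, fderiv_fderiv_graphMap hF, w, map_sum, map_smul]
  rw [Submodule.starProjection_apply_eq_zero_iff, Submodule.orthogonal_orthogonal] at h1
  obtain ⟨u, hu⟩ := h1
  have hu' : fderiv ℝ (graphMap F) x u = inrCLM n m w := hu
  rw [fderiv_graphMap (hF.differentiableAt (by simp))] at hu'
  have hf := congrArg (fstCLM n m) hu'
  have hs := congrArg (sndCLM n m) hu'
  simp [inlCLM, inrCLM, fstCLM] at hf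
  simp [inlCLM, inrCLM, sndCLM, hf] at hs
  have := congrArg (fun z : E m => z a) hs.symm
  simpa [w] using this

theorem sum_fderiv_fluxCoeff_eq_zero {F : E n → E m} {x : E n} (hF : ContDiffAt ℝ ∞ F x)
    (hH : meanCurvature F x = 0) (a : Fin m) :
    ∑ i, fderiv ℝ (fun y => fluxCoeff (jacobian F y) i a) x (EuclideanSpace.single i 1) = 0 := by
  have hJ := contDiffAt_jacobian hF
  set D : Fin n → Matrix (Fin m) (Fin n) ℝ := fun i => Matrix.of fun b j =>
    (fderiv ℝ (fderiv ℝ F) x (EuclideanSpace.single i 1) (EuclideanSpace.single j 1)) b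
  have h1 : ∀ i, fderiv ℝ (fun y => fluxCoeff (jacobian F y) i a) x (EuclideanSpace.single i 1) =
      fluxDeriv (jacobian F x) (D i) i a := by
    intro i
    have hline : ContDiff ℝ ∞ fun t : ℝ => x + t • (EuclideanSpace.single i 1 : E n) :=
      contDiff_const.add (contDiff_id.smul contDiff_const)
    have hx : x + (0 : ℝ) • (EuclideanSpace.single i 1 : E n) = x := by simp
    have hc : ∀ b j, ContDiffAt ℝ ∞
        (fun t : ℝ => jacobian F (x + t • (EuclideanSpace.single i 1 : E n)) b j) 0 := by
      intro b j
      have := hJ b j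
      rw [← hx] at this
      exact this.comp (0 : ℝ) hline.contDiffAt
    have hd : HasEntrywiseDerivAt
        (fun t : ℝ => jacobian F (x + t • (EuclideanSpace.single i 1 : E n))) (D i) 0 := by
      intro b j
      have h2 : DifferentiableAt ℝ (fderiv ℝ F) x :=
        (hF.fderiv_right (m := ∞) (by simp)).differentiableAt (by simp)
      have h3 : HasFDerivAt (fun y => jacobian F y b j)
          ((EuclideanSpace.proj b : E m →L[ℝ] ℝ) ∘L
            (ContinuousLinearMap.apply ℝ (E m) (EuclideanSpace.single j 1 : E n)) ∘L
              fderiv ℝ (fderiv ℝ F) x) x :=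
        (EuclideanSpace.proj b : E m →L[ℝ] ℝ).hasFDerivAt.comp x
          ((ContinuousLinearMap.apply ℝ (E m)
            (EuclideanSpace.single j 1 : E n)).hasFDerivAt.comp x h2.hasFDerivAt)
      exact (h3.hasLineDerivAt (EuclideanSpace.single i 1 : E n))
    have h4 := hasEntrywiseDerivAt_fluxCoeff hc hd i a
    have h5 := (((contDiffAt_fluxCoeff hJ i a).differentiableAt (by simp)).hasFDerivAt).hasLineDerivAt
      (EuclideanSpace.single i 1 : E n)
    rw [hx] at h4
    exact HasDerivAt.unique h5 h4
  simp_rw [h1]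
  refine sum_fluxDeriv_eq_zero _ D (fun b i j => ?_) (sum_inv_matG_mul_eq_zero hF hH) a
  have := (hF.isSymmSndFDerivAt
    (by rw [minSmoothness_of_isRCLikeNormedField]
        exact WithTop.coe_le_coe.2 (le_top (a := (2 : ℕ∞)))))
    (EuclideanSpace.single i 1) (EuclideanSpace.single j 1)
  simp only [D, Matrix.of_apply, this]

/-! ### Closedness -/

theorem clm_fstCLM_apply (L : E n →L[ℝ] ℝ) (w : Amb n m) :
    L (fstCLM n m w) = ∑ k, L (EuclideanSpace.single k 1) * dx k w := by
  conv_lhs => rw [← (EuclideanSpace.basisFun (Fin n) ℝ).sum_repr (fstCLM n m w)]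
  simp only [map_sum, map_smul, smul_eq_mul, EuclideanSpace.basisFun_apply,
    EuclideanSpace.basisFun_repr]
  exact Finset.sum_congr rfl fun k _ => mul_comm _ _

/-- The coefficient of dx contributes nothing, since dx_k ∧ dx = 0. Wedging dx_k with dx in which
dxᵢ is replaced by dyₐ gives zero unless k = i, and then -dyₐ ∧ dx; what remains is the divergence
of the flux. -/
theorem extDeriv_Theta {F : E n → E m} {p : Amb n m} (hF : ContDiffAt ℝ ∞ F p.fst)
    (hH : meanCurvature F p.fst = 0) : extDeriv (Theta F) p = 0 := by
  have hJ := contDiffAt_jacobian hF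
  ext v
  rw [extDeriv_apply ((contDiffAt_Theta hF).differentiableAt (by simp))]
  have hb : DifferentiableAt ℝ (fun y => baseCoeff (jacobian F y)) p.fst :=
    (contDiffAt_baseCoeff hJ).differentiableAt (by simp)
  have hc : ∀ i a, DifferentiableAt ℝ (fun y => fluxCoeff (jacobian F y) i a) p.fst := fun i a =>
    (contDiffAt_fluxCoeff hJ i a).differentiableAt (by simp)
  set b' : Fin n → ℝ := fun k =>
    fderiv ℝ (fun y => baseCoeff (jacobian F y)) p.fst (EuclideanSpace.single k 1)
  set c' : Fin n → Fin m → Fin n → ℝ := fun i a k =>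
    fderiv ℝ (fun y => fluxCoeff (jacobian F y) i a) p.fst (EuclideanSpace.single k 1)
  have h1 : ∀ (u : Fin n → Amb n m) (w : Amb n m), fderiv ℝ (fun q => Theta F q u) p w =
      (∑ k, b' k * dx k w) * rowForm dx u +
        ∑ i, ∑ a, (∑ k, c' i a k * dx k w) * rowForm (Function.update dx i (dy a)) u := by
    intro u w
    have e : (fun q => Theta F q u) = fun q =>
        baseCoeff (jacobian F (fstCLM n m q)) * rowForm dx u + ∑ i, ∑ a,
          fluxCoeff (jacobian F (fstCLM n m q)) i a * rowForm (Function.update dx i (dy a)) u := by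
      funext q
      simp only [Theta_eq, ContinuousAlternatingMap.add_apply, ContinuousAlternatingMap.smul_apply,
        ContinuousAlternatingMap.sum_apply, smul_eq_mul]
      rfl
    rw [e, fderiv_sum_comp_mul_const (fstCLM n m) (f := fun y => baseCoeff (jacobian F y))
      (g := fun i a y => fluxCoeff (jacobian F y) i a) hb hc]
    exact congrArg₂ (· + ·) (congrArg (· * rowForm dx u) (clm_fstCLM_apply _ w))
      (Finset.sum_congr rfl fun i _ => Finset.sum_congr rfl fun a _ =>
        congrArg (· * rowForm (Function.update dx i (dy a)) u) (clm_fstCLM_apply _ w))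
  have h2 : ∀ (φ : Fin n → Amb n m →L[ℝ] ℝ) (f : Fin n → ℝ),
      ∑ j : Fin (n + 1), (-1) ^ (j : ℕ) * ((∑ k, f k * dx k (v j)) * rowForm φ (j.removeNth v)) =
        ∑ k, f k * rowForm (Fin.cons (dx k) φ : Fin (n + 1) → Amb n m →L[ℝ] ℝ) v := by
    intro φ f
    simp_rw [rowForm_cons, Finset.sum_mul, Finset.mul_sum]
    rw [Finset.sum_comm]
    exact Finset.sum_congr rfl fun k _ => Finset.sum_congr rfl fun j _ => by ring
  have hz : ∀ (j : ℕ) (y : ℝ), (-1 : ℤ) ^ j • y = (-1 : ℝ) ^ j * y := fun j y => by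
    rw [zsmul_eq_mul]; push_cast; rfl
  simp_rw [h1, hz, mul_add, Finset.sum_add_distrib]
  rw [h2]
  have h3 : ∀ k, rowForm (Fin.cons (dx k) dx : Fin (n + 1) → Amb n m →L[ℝ] ℝ) v = 0 := fun k =>
    rowForm_eq_zero (i := 0) (j := k.succ) (Fin.succ_ne_zero k).symm (by simp) v
  have h4 : ∀ i a, ∑ k, c' i a k *
      rowForm (Fin.cons (dx k) (Function.update dx i (dy a)) : Fin (n + 1) → Amb n m →L[ℝ] ℝ) v =
      -(c' i a i * rowForm (Fin.cons (dy a) dx : Fin (n + 1) → Amb n m →L[ℝ] ℝ) v) := by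
    intro i a
    rw [Finset.sum_eq_single i]
    · rw [rowForm_cons_update_self, mul_neg]
    · intro k _ hk
      rw [rowForm_eq_zero (i := 0) (j := k.succ) (Fin.succ_ne_zero k).symm (by simp [hk]), mul_zero]
    · simp
  have h5 : ∀ a, ∑ i, c' i a i = 0 := sum_fderiv_fluxCoeff_eq_zero hF hH
  have h6 : ∑ j : Fin (n + 1), (-1 : ℝ) ^ (j : ℕ) * ∑ i, ∑ a, (∑ k, c' i a k * dx k (v j)) *
        rowForm (Function.update dx i (dy a)) (j.removeNth v) =
      ∑ i, ∑ a, ∑ j : Fin (n + 1), (-1 : ℝ) ^ (j : ℕ) * ((∑ k, c' i a k * dx k (v j)) *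
        rowForm (Function.update dx i (dy a)) (j.removeNth v)) := by
    simp_rw [Finset.mul_sum]
    rw [Finset.sum_comm]
    exact Finset.sum_congr rfl fun i _ => Finset.sum_comm
  rw [h6]
  simp_rw [h2, h3, h4]
  rw [Finset.sum_comm]
  simp_rw [Finset.sum_neg_distrib, ← Finset.sum_mul, h5]
  simp

end MinimalGraph

end

/-! ### The theorem -/

theorem mainTheorem2 :
    ∃ ε : ℝ, 0 < ε ∧
      ∀ (n m : ℕ) (Ω : Set (MinimalGraph.E n)) (F : MinimalGraph.E n → MinimalGraph.E m),
        IsOpen Ω → IsConnected Ω → MinimalGraph.IsMinimalMap F Ω →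
        2 ≤ MinimalGraph.supRank F Ω →
        (∀ x ∈ Ω, ∀ j k : ℕ, j < k → k < MinimalGraph.supRank F Ω →
          (fderiv ℝ F x : MinimalGraph.E n →ₗ[ℝ] MinimalGraph.E m).singularValues j *
            (fderiv ℝ F x : MinimalGraph.E n →ₗ[ℝ] MinimalGraph.E m).singularValues k ≤
              ε / ((MinimalGraph.supRank F Ω : ℝ) - 1)) →
        MinimalGraph.IsCalibration (MinimalGraph.Theta F) (MinimalGraph.cylinder m Ω) := by
  -- The weight estimate needs qr ≤ 1/50 with q = ε/(r - 1); as r ≥ 2 gives r ≤ 2(r - 1), ε = 1/100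
  -- suffices.
  refine ⟨1 / 100, by norm_num, fun n m Ω F hΩ _ hF hr hsv => ?_⟩
  have hFx : ∀ x ∈ Ω, ContDiffAt ℝ ∞ F x := fun x hx => hF.smooth.contDiffAt (hΩ.mem_nhds hx)
  refine ⟨fun p hp => (MinimalGraph.contDiffAt_Theta (hFx p.fst hp)).contDiffWithinAt,
    fun p hp => MinimalGraph.extDeriv_Theta (hFx p.fst hp) (hF.meanCurvature_eq_zero p.fst hp), ?_⟩
  refine iSup₂_le fun p hp => iSup_le fun v => ?_
  have hr' : (2 : ℝ) ≤ MinimalGraph.supRank F Ω := by exact_mod_cast hr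
  set r := MinimalGraph.supRank F Ω with hrdef
  have hrank : Module.finrank ℝ (LinearMap.range
      (fderiv ℝ F p.fst : MinimalGraph.E n →ₗ[ℝ] MinimalGraph.E m)) ≤ r := by
    refine le_ciSup (f := fun x : Ω => Module.finrank ℝ (LinearMap.range
      (fderiv ℝ F x : MinimalGraph.E n →ₗ[ℝ] MinimalGraph.E m))) ?_ ⟨p.fst, hp⟩
    -- A supremum in ℕ bounds its terms only if the family is bounded; n bounds all the ranks.
    refine ⟨n, ?_⟩
    rintro _ ⟨x, rfl⟩
    exact (LinearMap.finrank_range_le _).trans (by simp)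
  have hone : (1 : EReal) = ((1 : ℝ) : EReal) := rfl
  rw [hone, EReal.coe_le_coe_iff]
  refine MinimalGraph.thetaCovector_le_one
    (fderiv ℝ F p.fst : MinimalGraph.E n →ₗ[ℝ] MinimalGraph.E m) _ (fun u => ?_)
    (r := r) (q := 1 / 100 / ((r : ℝ) - 1)) (by
      have : (0 : ℝ) < (r : ℝ) - 1 := by linarith
      positivity) ?_ (fun i hi => ?_) (hsv p.fst hp) v.2
  · ext a
    conv_lhs => rw [← (EuclideanSpace.basisFun (Fin n) ℝ).sum_repr u]
    simp [MinimalGraph.jacobian, Matrix.mulVec, dotProduct, mul_comm]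
  · rw [div_mul_eq_mul_div, div_le_iff₀ (by linarith)]
    linarith
  -- Singular values are indexed from 0, so those of index at least the rank vanish.
  · exact LinearMap.singularValues_eq_zero_iff_le_finrank_range _ |>.2 (hrank.trans hi)
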